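/- Theorem A. For a group $G$ and a finite symmetric generating set $S$, let $\gamma_S(n)$ be the number of elements of $G$ that are products of at most $n$ elements of $S$; a finitely generated group has intermediate growth if $\gamma_S(n)/n^d\to\infty$ for all $d\in\mathbb N$ and $\gamma_S(n)/c^n\to 0$ for all $c>1$ (for every such $S$). Let $H$ be the Grigorchuk–Maki group, i.e. the group of permutations of $\mathbb{Z}^{\mathbb N}$ generated by $a,b,c,d$, where $a(l_1,l_2,\ldots)=(1+l_1,l_2,\ldots)$; $b(l_1,w)=(l_1,a(w))$, $c(l_1,w)=(l_1,a(w))$, $d(l_1,w)=(l_1,w)$ if $l_1$ is even; and $b(l_1,w)=(l_1,c(w))$, $c(l_1,w)=(l_1,d(w))$, $d(l_1,w)=(l_1,b(w))$ if $l_1$ is odd. Let $\mathrm{Diff}^1_+([0,1])$ be the group of orientation preserving $C^1$ diffeomorphisms of $[0,1]$. (1) There is a finitely generated subgroup of $\mathrm{Diff}^1_+([0,1])$ with intermediate growth, and it can be taken isomorphic to $H$. (2) Let $\sigma:[0,1]\to[0,\sigma(1)]$ be any increasing homeomorphism such that $\sigma(s)=1/\log(1/s)$ for $0<s\le 1/e$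 and $s\mapsto\sigma(s)/s$ is (weakly) decreasing on $(0,1]$. For $\psi:[0,1]\to\mathbb R$ put $\|\psi\|_\sigma=\sup_{x\ne y}|\psi(x)-\psi(y)|/\sigma(|x-y|)$, and let $\mathrm{Diff}^{1+\sigma}_+([0,1])$ be the group of those $f\in\mathrm{Diff}^1_+([0,1])$ for which $\|f'\|_\sigma$ and $\|(f^{-1})'\|_\sigma$ are finite. Then for every $\varepsilon>0$ there is an injective homomorphism $\phi:H\to\mathrm{Diff}^{1+\sigma}_+([0,1])$ such that, for each $h\in\{a,b,c,d\}$, both $f=\phi(h)$ and $f=\phi(h)^{-1}$ satisfy $\sup_x|f(x)-x|\le\varepsilon$, $\sup_x|f'(x)-1|\le\varepsilon$ and $\|f'\|_\sigma\le\varepsilon$. -/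

import Mathlib

open Set Filter Topology

/-! ### Growth of groups -/

/-- The growth function of a group `G` with respect to a finite set `S`: the number of elements
of `G` that can be written as a product of at most `n` elements of `S`. -/
noncomputable def growthFunction {G : Type*} [Group G] (S : Finset G) (n : ℕ) : ℕ :=
  Set.ncard {g : G | ∃ w : List G, w.length ≤ n ∧ (∀ s ∈ w, s ∈ S) ∧ w.prod = g}

/-- A finitely generated group has intermediate growth if its growth function, with respect to any
finite symmetric system of generators, grows faster than every polynomial and
slower than every exponential. -/
def HasIntermediateGrowth (G : Type*) [Group G] : Prop :=
  Group.FG G ∧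
    ∀ S : Finset G, (∀ s ∈ S, s⁻¹ ∈ S) → Subgroup.closure (S : Set G) = ⊤ →
      (∀ d : ℕ, Tendsto (fun n : ℕ => (growthFunction S n : ℝ) / (n : ℝ) ^ d) atTop atTop) ∧
      (∀ c : ℝ, 1 < c →
        Tendsto (fun n : ℕ => (growthFunction S n : ℝ) / c ^ n) atTop (𝓝 0))

/-! ### The Grigorchuk–Maki group, acting on the space of integer sequences -/

/-- Labels for the generators of the Grigorchuk–Maki group, together with the identity. -/
inductive GMLabel
  | one
  | a
  | b
  | c
  | d

/-- The label of the map that acts on the tail `(l₂, l₃, …)` of a sequence with first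
entry `k`. -/
def GMLabel.next : GMLabel → ℤ → GMLabel
  | .b, k => if Even k then .a else .c
  | .c, k => if Even k then .a else .d
  | .d, k => if Even k then .one else .b
  | .a, _ => .one
  | .one, _ => .one

/-- The amount by which a generator translates the first entry of a sequence. -/
def GMLabel.shift : GMLabel → ℤ
  | .a => 1
  | _ => 0

/-- The action of a generator (`e = 1`) or of its inverse (`e = -1`) on integer sequences. -/
def gmAct (e : ℤ) : GMLabel → (ℕ → ℤ) → ℕ → ℤ
  | s, l, 0 => l 0 + e * s.shift
  | s, l, n + 1 => gmAct e (s.next (l 0)) (fun k => l (k + 1)) n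

theorem GMLabel.next_add_shift (s : GMLabel) (e k : ℤ) : s.next (k + e * s.shift) = s.next k := by
  cases s <;> simp [GMLabel.next, GMLabel.shift]

theorem gmAct_gmAct_neg (e : ℤ) (n : ℕ) :
    ∀ (s : GMLabel) (l : ℕ → ℤ), gmAct e s (gmAct (-e) s l) n = l n := by
  induction n with
  | zero => intro s l; simp [gmAct]
  | succ n ih =>
    intro s l
    have h0 : gmAct (-e) s l 0 = l 0 + (-e) * s.shift := rfl
    have h1 : (fun k => gmAct (-e) s l (k + 1))
        = gmAct (-e) (s.next (l 0)) (fun k => l (k + 1)) := rfl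
    show gmAct e (s.next (gmAct (-e) s l 0)) (fun k => gmAct (-e) s l (k + 1)) n = l (n + 1)
    rw [h0, h1, GMLabel.next_add_shift, ih]

/-- The permutation of the space of integer sequences given by a generator. -/
def gmPerm (s : GMLabel) : Equiv.Perm (ℕ → ℤ) where
  toFun := gmAct 1 s
  invFun := gmAct (-1) s
  left_inv l := by
    funext n
    simpa using gmAct_gmAct_neg (-1) n s l
  right_inv l := by
    funext n
    exact gmAct_gmAct_neg 1 n s l

/-- The sequence `(k, l₁, l₂, …)`. -/
def seqCons (k : ℤ) (l : ℕ → ℤ) : ℕ → ℤ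
  | 0 => k
  | n + 1 => l n

theorem gmPerm_one : gmPerm .one = 1 := by
  have key : ∀ (n : ℕ) (l : ℕ → ℤ), gmAct 1 .one l n = l n := by
    intro n
    induction n with
    | zero => intro l; simp [gmAct, GMLabel.shift]
    | succ n ih => intro l; simp [gmAct, GMLabel.next, ih]
  ext l n
  exact key n l

theorem gmPerm_a (k : ℤ) (l : ℕ → ℤ) : gmPerm .a (seqCons k l) = seqCons (1 + k) l := by
  funext n
  cases n with
  | zero => simp [gmPerm, gmAct, GMLabel.shift, seqCons, add_comm]
  | succ n => exact congrFun (congrFun (congrArg DFunLike.coe gmPerm_one) l) n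

theorem gmPerm_b (k : ℤ) (l : ℕ → ℤ) : gmPerm .b (seqCons k l)
    = seqCons k (if Even k then gmPerm .a l else gmPerm .c l) := by
  funext n
  cases n <;> by_cases hk : Even k <;>
    simp [gmPerm, gmAct, GMLabel.shift, GMLabel.next, seqCons, hk]

theorem gmPerm_c (k : ℤ) (l : ℕ → ℤ) : gmPerm .c (seqCons k l)
    = seqCons k (if Even k then gmPerm .a l else gmPerm .d l) := by
  funext n
  cases n <;> by_cases hk : Even k <;>
    simp [gmPerm, gmAct, GMLabel.shift, GMLabel.next, seqCons, hk]

theorem gmPerm_d (k : ℤ) (l : ℕ → ℤ) : gmPerm .d (seqCons k l)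
    = seqCons k (if Even k then l else gmPerm .b l) := by
  have h1 : gmPerm .one l = l := by rw [gmPerm_one]; rfl
  have h2 : gmPerm .d (seqCons k l)
      = seqCons k (if Even k then gmPerm .one l else gmPerm .b l) := by
    funext n
    cases n <;> by_cases hk : Even k <;>
      simp [gmPerm, gmAct, GMLabel.shift, GMLabel.next, seqCons, hk]
  rw [h2, h1]

/-- The four canonical generators of the Grigorchuk–Maki group. -/
def gmGenerators : Set (Equiv.Perm (ℕ → ℤ)) :=
  {gmPerm .a, gmPerm .b, gmPerm .c, gmPerm .d}

/-- The Grigorchuk–Maki group `H`. -/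
def grigorchukMaki : Subgroup (Equiv.Perm (ℕ → ℤ)) := Subgroup.closure gmGenerators

/-! ### Diffeomorphisms of the interval -/

/-- A homeomorphism of `[0,1]`, seen as a real function (constant on each side of `[0,1]`). -/
noncomputable def intervalFun (f : unitInterval ≃ₜ unitInterval) (x : ℝ) : ℝ :=
  f (Set.projIcc 0 1 zero_le_one x)

/-- The derivative of a homeomorphism of `[0,1]` (one-sided at the end points). -/
noncomputable def intervalDeriv (f : unitInterval ≃ₜ unitInterval) (x : ℝ) : ℝ :=
  derivWithin (intervalFun f) (Set.Icc 0 1) x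

theorem intervalFun_mapsTo (f : unitInterval ≃ₜ unitInterval) :
    Set.MapsTo (intervalFun f) (Set.Icc 0 1) (Set.Icc 0 1) :=
  fun x _ => (f (Set.projIcc 0 1 zero_le_one x)).2

theorem intervalFun_mul (f g : unitInterval ≃ₜ unitInterval) :
    intervalFun (f * g) = intervalFun f ∘ intervalFun g := by
  funext x
  simp [intervalFun]

/-- `Diff¹₊([0,1])`: the group of orientation preserving `C¹` diffeomorphisms of `[0,1]`. -/
def diffOne : Subgroup (unitInterval ≃ₜ unitInterval) where
  carrier := {f | Monotone f ∧ ContDiffOn ℝ 1 (intervalFun f) (Set.Icc 0 1) ∧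
    ContDiffOn ℝ 1 (intervalFun f⁻¹) (Set.Icc 0 1)}
  one_mem' := by
    have h : ContDiffOn ℝ 1 (intervalFun 1) (Set.Icc 0 1) := by
      refine contDiffOn_id.congr fun x hx => ?_
      simp [intervalFun, Set.projIcc_of_mem zero_le_one hx]
    refine ⟨fun x y hxy => hxy, h, ?_⟩
    rw [inv_one]
    exact h
  mul_mem' := by
    rintro f g ⟨hf, hf1, hf2⟩ ⟨hg, hg1, hg2⟩
    refine ⟨hf.comp hg, ?_, ?_⟩
    · rw [intervalFun_mul]
      exact hf1.comp hg1 (intervalFun_mapsTo g)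
    · rw [mul_inv_rev, intervalFun_mul]
      exact hg2.comp hf2 (intervalFun_mapsTo _)
  inv_mem' := by
    rintro f ⟨hf, hf1, hf2⟩
    refine ⟨fun x y hxy => ?_, hf2, by rwa [inv_inv]⟩
    have hs : StrictMono f := hf.strictMono_of_injective f.injective
    refine hs.le_iff_le.1 ?_
    have h (z : unitInterval) : f (f⁻¹ z) = z := f.apply_symm_apply z
    rwa [h, h]

/-! ### Moduli of continuity -/

/-- A modulus of continuity `σ : [0,1] → [0,σ(1)]` (an increasing homeomorphism) which satisfies
`σ(s) = 1/log(1/s)` for `0 < s ≤ 1/e`, and such that `s ↦ σ(s)/s` is decreasing. -/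
structure IsLogModulus (σ : ℝ → ℝ) : Prop where
  continuousOn : ContinuousOn σ (Set.Icc 0 1)
  strictMonoOn : StrictMonoOn σ (Set.Icc 0 1)
  map_zero : σ 0 = 0
  eq_log : ∀ s : ℝ, 0 < s → s ≤ Real.exp (-1) → σ s = 1 / Real.log (1 / s)
  antitoneOn : AntitoneOn (fun s => σ s / s) (Set.Ioc 0 1)

/-- The `σ`-norm of `ψ : [0,1] → ℝ` is at most `M`. -/
def SigmaNormLE (σ ψ : ℝ → ℝ) (M : ℝ) : Prop :=
  ∀ x ∈ Set.Icc (0 : ℝ) 1, ∀ y ∈ Set.Icc (0 : ℝ) 1, x ≠ y → |(ψ x - ψ y) / σ (|x - y|)| ≤ M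

/-- `Diff^{1+σ}₊([0,1])`: the orientation preserving `C¹` diffeomorphisms `f` of `[0,1]` such that
the derivatives of `f` and `f⁻¹` are `σ`-continuous. -/
def diffOneSigma (σ : ℝ → ℝ) : Set diffOne :=
  {f | (∃ M : ℝ, SigmaNormLE σ (intervalDeriv f.1) M) ∧
    ∃ M : ℝ, SigmaNormLE σ (intervalDeriv f.1⁻¹) M}

/-- `f` is `ε`-close to the identity in the `C^{1+σ}` topology. -/
def IsSigmaCloseToId (σ : ℝ → ℝ) (ε : ℝ) (f : diffOne) : Prop :=
  (∀ x : unitInterval, |(f.1 x : ℝ) - x| ≤ ε) ∧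
  (∀ x ∈ Set.Icc (0 : ℝ) 1, |intervalDeriv f.1 x - 1| ≤ ε) ∧
  SigmaNormLE σ (intervalDeriv f.1) ε

/-! Growth is studied through sections: an element whose action on the first entry is a translation
by `s` has the form `vert (g₀, g₁) * a ^ s`. Since `b`, `c`, `d` commute, each element is a word
alternating between powers of `a` and triples of exponents of `b`, `c`, `d`. These exponents are
unbounded, so a ball is described by three numbers: the total exponent `A` of `a`, the total
exponent `X` of `b`, `c`, `d`, and a weight `W` depending only on parities. In passing to the two
sections, the total weight drops to about `5/6 * W`, while the total exponents of both kinds are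
bounded by `X` (`exists_sections`). An exponential bound with rates `(α, ξ, β)` thus improves to
`(0, α + ξ, 5/6 * β)` (`GrowthBound.contract`). Elementary counting gives rates `(α, α, β)` for
arbitrarily small `α > 0` and some `β`; iterating the contraction kills `β`, and growth is
subexponential (`growthBound_zero`).

Growth exceeds every polynomial because conjugates of `b²` translate a deep entry by `2` on one
prescribed parity class of prefixes and fix that entry on the others (`exists_translatesEntry`).
Their powers are independent, and there are `2 ^ (3 * j + 1)` classes at depth `3 * j + 1`.

For the smooth action, the displacement of an entry depends only on the parities of the preceding
ones, so the group preserves the lexicographic order on words of each length. Disjoint intervals,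
one for each finite word, are placed in `[0,1]` in this order and mapped to each other by Yoccoz'
family, whose cocycle relation `yoccoz_yoccoz` turns the order action into a group action. The
derivatives equal `1` at end points, so the maps glue. Lengths `exp (-√(K * ‖w‖₁ + C n))` are
summable for fixed `n`; as a group element moves words a bounded `ℓ¹` distance, `√q` changes by `O(K
/ √q)`, which is exactly what the modulus `1 / log (1 / s)` tolerates
(`abs_yoccozDeriv_sub_le_of_isLogModulus`). Small `K` brings the generators close to the identity.
-/

namespace GrigorchukMaki

/-! ### Permutations of the space of integer sequences -/

/-- The tail `(l₁, l₂, …)` of a sequence `(l₀, l₁, l₂, …)`. -/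
def seqTail (l : ℕ → ℤ) : ℕ → ℤ := fun n => l (n + 1)

@[simp] theorem seqCons_zero (k : ℤ) (l : ℕ → ℤ) : seqCons k l 0 = k := rfl

@[simp] theorem seqCons_succ (k : ℤ) (l : ℕ → ℤ) (n : ℕ) : seqCons k l (n + 1) = l n := rfl

@[simp] theorem seqTail_seqCons (k : ℤ) (l : ℕ → ℤ) : seqTail (seqCons k l) = l := rfl

@[simp] theorem seqCons_seqTail (l : ℕ → ℤ) : seqCons (l 0) (seqTail l) = l := by
  funext n
  cases n <;> rfl

@[simp] theorem seqTail_apply (l : ℕ → ℤ) (n : ℕ) : seqTail l n = l (n + 1) := rfl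

theorem perm_ext_cons {g h : Equiv.Perm (ℕ → ℤ)}
    (H : ∀ k l, g (seqCons k l) = h (seqCons k l)) : g = h := by
  ext1 l
  rw [← seqCons_seqTail l]
  exact H _ _

/-- The permutation fixing the first entry of a sequence and acting on the tail by `p.1` or `p.2`
according to the parity of this entry. -/
def vert : Equiv.Perm (ℕ → ℤ) × Equiv.Perm (ℕ → ℤ) →* Equiv.Perm (ℕ → ℤ) where
  toFun p :=
    { toFun := fun l => seqCons (l 0) (if Even (l 0) then p.1 (seqTail l) else p.2 (seqTail l))
      invFun := fun l =>
        seqCons (l 0) (if Even (l 0) then p.1.symm (seqTail l) else p.2.symm (seqTail l))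
      left_inv := fun l => by
        by_cases h : Even (l 0) <;> simp [h]
      right_inv := fun l => by
        by_cases h : Even (l 0) <;> simp [h] }
  map_one' := perm_ext_cons fun k l => by simp
  map_mul' p q := perm_ext_cons fun k l => by
    by_cases h : Even k <;> simp [h]

theorem vert_apply (p : Equiv.Perm (ℕ → ℤ) × Equiv.Perm (ℕ → ℤ)) (l : ℕ → ℤ) :
    vert p l = seqCons (l 0) (if Even (l 0) then p.1 (seqTail l) else p.2 (seqTail l)) := rfl

@[simp] theorem vert_seqCons (p : Equiv.Perm (ℕ → ℤ) × Equiv.Perm (ℕ → ℤ)) (k : ℤ) (l : ℕ → ℤ) :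
    vert p (seqCons k l) = seqCons k (if Even k then p.1 l else p.2 l) := rfl

theorem gmPerm_b_eq : gmPerm .b = vert (gmPerm .a, gmPerm .c) :=
  perm_ext_cons fun k l => by rw [gmPerm_b, vert_seqCons]

theorem gmPerm_c_eq : gmPerm .c = vert (gmPerm .a, gmPerm .d) :=
  perm_ext_cons fun k l => by rw [gmPerm_c, vert_seqCons]

theorem gmPerm_d_eq : gmPerm .d = vert (1, gmPerm .b) :=
  perm_ext_cons fun k l => by rw [gmPerm_d, vert_seqCons]; rfl

theorem gmPerm_a_zpow (k j : ℤ) (l : ℕ → ℤ) :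
    (gmPerm .a ^ k) (seqCons j l) = seqCons (j + k) l := by
  induction k using Int.induction_on generalizing j with
  | zero => simp
  | succ n ih =>
    rw [zpow_add, zpow_one, Equiv.Perm.mul_apply, gmPerm_a, ih]
    ring_nf
  | pred n ih =>
    rw [zpow_sub, zpow_one, Equiv.Perm.mul_apply]
    have : (gmPerm .a)⁻¹ (seqCons j l) = seqCons (j - 1) l := by
      rw [Equiv.Perm.inv_eq_iff_eq, gmPerm_a]
      ring_nf
    rw [this, ih]
    ring_nf

theorem a_mul_vert_of_odd {k : ℤ} (hk : Odd k) (g h : Equiv.Perm (ℕ → ℤ)) :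
    gmPerm .a ^ k * vert (g, h) = vert (h, g) * gmPerm .a ^ k :=
  perm_ext_cons fun j l => by
    have : Even (j + k) ↔ ¬ Even j := by
      rw [Int.even_add]
      simp [Int.not_even_iff_odd.2 hk]
    by_cases h : Even j <;> simp [gmPerm_a_zpow, this, h]

theorem a_mul_vert_of_even {k : ℤ} (hk : Even k) (p : Equiv.Perm (ℕ → ℤ) × Equiv.Perm (ℕ → ℤ)) :
    gmPerm .a ^ k * vert p = vert p * gmPerm .a ^ k :=
  perm_ext_cons fun j l => by
    have : Even (j + k) ↔ Even j := by
      rw [Int.even_add]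
      simp [hk]
    by_cases h : Even j <;> simp [gmPerm_a_zpow, this, h]

/-- At an even first entry the sections are powers of `a`. At an odd one the pairs `(b, c)`, `(c,
d)`, `(d, b)` are permuted cyclically, so the three relations need a joint induction. -/
theorem commute_bcd_aux (n : ℕ) : ∀ l : ℕ → ℤ,
    (gmPerm .b * gmPerm .c) l n = (gmPerm .c * gmPerm .b) l n ∧
    (gmPerm .c * gmPerm .d) l n = (gmPerm .d * gmPerm .c) l n ∧
    (gmPerm .d * gmPerm .b) l n = (gmPerm .b * gmPerm .d) l n := by
  induction n with
  | zero =>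
    intro l
    obtain ⟨k, w, rfl⟩ : ∃ k w, l = seqCons k w := ⟨_, _, (seqCons_seqTail l).symm⟩
    simp [gmPerm_b, gmPerm_c, gmPerm_d]
  | succ n ih =>
    intro l
    obtain ⟨k, w, rfl⟩ : ∃ k w, l = seqCons k w := ⟨_, _, (seqCons_seqTail l).symm⟩
    have := ih w
    by_cases h : Even k
    · simp [gmPerm_b, gmPerm_c, gmPerm_d, h]
    · simp only [Equiv.Perm.mul_apply] at this
      simp [gmPerm_b, gmPerm_c, gmPerm_d, h, this]

theorem commute_b_c : Commute (gmPerm .b) (gmPerm .c) :=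
  Equiv.ext fun l => funext fun n => (commute_bcd_aux n l).1

theorem commute_c_d : Commute (gmPerm .c) (gmPerm .d) :=
  Equiv.ext fun l => funext fun n => (commute_bcd_aux n l).2.1

theorem commute_b_d : Commute (gmPerm .b) (gmPerm .d) :=
  Equiv.ext fun l => funext fun n => (commute_bcd_aux n l).2.2.symm

/-- The element `b ^ β * c ^ γ * d ^ δ`. -/
def bcd (x : ℤ × ℤ × ℤ) : Equiv.Perm (ℕ → ℤ) :=
  gmPerm .b ^ x.1 * (gmPerm .c ^ x.2.1 * gmPerm .d ^ x.2.2)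

theorem bcd_add (x y : ℤ × ℤ × ℤ) : bcd (x + y) = bcd x * bcd y := by
  have h1 := (commute_c_d.zpow_zpow x.2.1 y.2.2)
  have h2 := (commute_b_c.zpow_zpow y.1 x.2.1)
  have h3 := (commute_b_d.zpow_zpow y.1 x.2.2)
  have h4 := (commute_c_d.zpow_zpow y.2.1 x.2.2)
  simp only [bcd, Prod.fst_add, Prod.snd_add, zpow_add]
  have e1 : gmPerm .b ^ x.1 * (gmPerm .c ^ x.2.1 * gmPerm .d ^ x.2.2) *
      (gmPerm .b ^ y.1 * (gmPerm .c ^ y.2.1 * gmPerm .d ^ y.2.2))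
      = gmPerm .b ^ x.1 * (gmPerm .c ^ x.2.1 * ((gmPerm .d ^ x.2.2 * gmPerm .b ^ y.1) *
      (gmPerm .c ^ y.2.1 * gmPerm .d ^ y.2.2))) := by group
  rw [e1, ← h3.eq]
  have e2 : gmPerm .b ^ x.1 * (gmPerm .c ^ x.2.1 * ((gmPerm .b ^ y.1 * gmPerm .d ^ x.2.2) *
      (gmPerm .c ^ y.2.1 * gmPerm .d ^ y.2.2))) =
      gmPerm .b ^ x.1 * ((gmPerm .c ^ x.2.1 * gmPerm .b ^ y.1) * ((gmPerm .d ^ x.2.2 *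
      gmPerm .c ^ y.2.1) * gmPerm .d ^ y.2.2)) := by simp only [mul_assoc]
  rw [e2, ← h2.eq, ← h4.eq]
  simp only [mul_assoc]

/-- The cyclic permutation of exponents describing the section of `bcd x` at odd entries. -/
def rot (x : ℤ × ℤ × ℤ) : ℤ × ℤ × ℤ := (x.2.2, x.1, x.2.1)

theorem bcd_eq_vert (x : ℤ × ℤ × ℤ) :
    bcd x = vert (gmPerm .a ^ (x.1 + x.2.1), bcd (rot x)) := by
  have h1 := (commute_b_c.zpow_zpow x.2.2 x.1)
  have h2 := (commute_b_d.zpow_zpow x.2.2 x.2.1)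
  have hb : gmPerm .b ^ x.1 = vert ((gmPerm .a, gmPerm .c) ^ x.1) := by
    rw [map_zpow, ← gmPerm_b_eq]
  have hc : gmPerm .c ^ x.2.1 = vert ((gmPerm .a, gmPerm .d) ^ x.2.1) := by
    rw [map_zpow, ← gmPerm_c_eq]
  have hd : gmPerm .d ^ x.2.2 = vert ((1, gmPerm .b) ^ x.2.2) := by
    rw [map_zpow, ← gmPerm_d_eq]
  rw [bcd, hb, hc, hd, ← map_mul, ← map_mul]
  congr 1
  simp only [Prod.pow_mk, Prod.mk_mul_mk, bcd, rot, one_zpow, mul_one, zpow_add]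
  rw [← mul_assoc, ← mul_assoc, h1.eq, mul_assoc, mul_assoc, h2.eq]

theorem gmPerm_mem (s : GMLabel) : gmPerm s ∈ grigorchukMaki := by
  cases s
  · rw [gmPerm_one]; exact one_mem _
  all_goals exact Subgroup.subset_closure (by simp [gmGenerators])

/-- An induction principle for the elements of the Grigorchuk–Maki group. -/
theorem closure_induction {P : Equiv.Perm (ℕ → ℤ) → Prop} (hone : P 1)
    (hgen : ∀ s : GMLabel, P (gmPerm s)) (hmul : ∀ g h, P g → P h → P (g * h))
    (hinv : ∀ g, P g → P g⁻¹) {g : Equiv.Perm (ℕ → ℤ)} (hg : g ∈ grigorchukMaki) : P g := by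
  refine Subgroup.closure_induction (p := fun g _ => P g) ?_ hone
    (fun x y _ _ hx hy => hmul x y hx hy) (fun x _ hx => hinv x hx) hg
  rintro _ (rfl | rfl | rfl | rfl) <;> exact hgen _

/-! ### Alternating words and their contraction -/

/-- A syllable `(x, k)` stands for the element `bcd x * a ^ k`. -/
abbrev Syllable := (ℤ × ℤ × ℤ) × ℤ

/-- The element represented by a list of syllables. -/
def wordEval : List Syllable → Equiv.Perm (ℕ → ℤ)
  | [] => 1
  | p :: L => bcd p.1 * gmPerm .a ^ p.2 * wordEval L

/-- The total exponent of `b`, `c`, `d`. -/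
def bcdLen (x : ℤ × ℤ × ℤ) : ℕ := x.1.natAbs + x.2.1.natAbs + x.2.2.natAbs

/-- The total absolute exponent of `a` in a list of syllables. -/
def aLength : List Syllable → ℕ
  | [] => 0
  | p :: L => p.2.natAbs + aLength L

/-- The total absolute exponent of `b`, `c`, `d` in a list of syllables. -/
def xLength : List Syllable → ℕ
  | [] => 0
  | p :: L => bcdLen p.1 + xLength L

/-- The weight of an exponent triple, which depends only on its class modulo two. -/
def triWeight (x : ℤ × ℤ × ℤ) : ℕ :=
  if Even (x.1 + x.2.1) then 4 else if Even (x.2.1 + x.2.2) then 6 else 5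

/-- The weight of a list of syllables. -/
def wordWeight : List Syllable → ℕ
  | [] => 0
  | p :: L => triWeight p.1 + wordWeight L

/-- A list of syllables alternates if all exponents of `a`, except possibly the last one,
are odd. -/
def Alternates : List Syllable → Prop
  | [] => True
  | [_] => True
  | p :: q :: L => Odd p.2 ∧ Alternates (q :: L)

theorem xLength_cons (p : Syllable) (L : List Syllable) :
    xLength (p :: L) = bcdLen p.1 + xLength L := rfl

theorem wordWeight_cons (p : Syllable) (L : List Syllable) :
    wordWeight (p :: L) = triWeight p.1 + wordWeight L := rfl

/-- Modulo two and modulo `(1, 1, 1)`, the exponents form a Klein four-group in which the weights of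
`1`, `d`, `c`, `b` are `4`, `4`, `5`, `6`. The tight case is `c * d = b`, with `6 + 3 = 5 + 4`. -/
theorem triWeight_add (x y : ℤ × ℤ × ℤ) :
    triWeight (x + y) + 3 ≤ triWeight x + triWeight y := by
  obtain ⟨x1, x2, x3⟩ := x
  obtain ⟨y1, y2, y3⟩ := y
  simp only [triWeight, Prod.mk_add_mk, Int.even_add]
  by_cases h1 : Even x1 <;> by_cases h2 : Even x2 <;> by_cases h3 : Even x3 <;>
    by_cases k1 : Even y1 <;> by_cases k2 : Even y2 <;> by_cases k3 : Even y3 <;>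
    simp [h1, h2, h3, k1, k2, k3]

/-- The cycle `b → c → d → b` contracts weights by `5/6` at `b` (`6 → 5`) and at `c` (`5 → 4`). Only
the classes of `d` and `1` fail, and these are the ones whose even section is an even power of `a`;
there the next junction allows a merge, and the `3` saved by `triWeight_add` repays the `18 = 6 *
3`. -/
theorem triWeight_rot (x : ℤ × ℤ × ℤ) :
    6 * triWeight (rot x) ≤ 5 * triWeight x + if Even (x.1 + x.2.1) then 18 else 0 := by
  obtain ⟨x1, x2, x3⟩ := x
  simp only [triWeight, rot, Int.even_add]
  by_cases h1 : Even x1 <;> by_cases h2 : Even x2 <;> by_cases h3 : Even x3 <;>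
    simp [h1, h2, h3]

theorem four_le_triWeight (x : ℤ × ℤ × ℤ) : 4 ≤ triWeight x := by
  unfold triWeight
  split_ifs <;> omega

theorem triWeight_le_six (x : ℤ × ℤ × ℤ) : triWeight x ≤ 6 := by
  unfold triWeight
  split_ifs <;> omega

theorem bcdLen_rot (x : ℤ × ℤ × ℤ) : bcdLen (rot x) = bcdLen x := by
  simp only [bcdLen, rot]
  omega

theorem bcdLen_add (x y : ℤ × ℤ × ℤ) : bcdLen (x + y) ≤ bcdLen x + bcdLen y := by
  simp only [bcdLen, Prod.fst_add, Prod.snd_add]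
  omega

theorem commute_bcd_a_of_even {k : ℤ} (hk : Even k) (x : ℤ × ℤ × ℤ) :
    gmPerm .a ^ k * bcd x = bcd x * gmPerm .a ^ k := by
  rw [bcd_eq_vert]
  exact a_mul_vert_of_even hk _

/-- An even power of `a` commutes with every `bcd x`, so the two syllables collapse into one. -/
theorem exists_merge {k : ℤ} (hk : Even k) (y : ℤ × ℤ × ℤ) (p : Syllable) {L : List Syllable}
    (hL : Alternates (p :: L)) :
    ∃ q, Alternates (q :: L) ∧
      bcd y * gmPerm .a ^ k * wordEval (p :: L) = wordEval (q :: L) ∧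
      aLength (q :: L) ≤ k.natAbs + aLength (p :: L) ∧
      xLength (q :: L) ≤ bcdLen y + xLength (p :: L) ∧
      wordWeight (q :: L) + 3 ≤ triWeight y + wordWeight (p :: L) := by
  refine ⟨(y + p.1, k + p.2), ?_, ?_, ?_, ?_, ?_⟩
  · cases L with
    | nil => trivial
    | cons q L => exact ⟨hk.add_odd hL.1, hL.2⟩
  · simp only [wordEval, bcd_add, zpow_add]
    calc bcd y * gmPerm .a ^ k * (bcd p.1 * gmPerm .a ^ p.2 * wordEval L)
        = bcd y * (gmPerm .a ^ k * bcd p.1) * gmPerm .a ^ p.2 * wordEval L := by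
          simp only [mul_assoc]
      _ = _ := by
          rw [commute_bcd_a_of_even hk]
          simp only [mul_assoc]
  · simp only [aLength]
    omega
  · simp only [xLength]
    have := bcdLen_add y p.1
    omega
  · simp only [wordWeight]
    have := triWeight_add y p.1
    omega

/-- Multiplying an alternating word by an element `bcd y * a ^ k` on the left. -/
theorem exists_prepend (y : ℤ × ℤ × ℤ) (k : ℤ) {L : List Syllable} (hL : Alternates L) :
    ∃ q L', Alternates (q :: L') ∧
      bcd y * gmPerm .a ^ k * wordEval L = wordEval (q :: L') ∧
      aLength (q :: L') ≤ k.natAbs + aLength L ∧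
      xLength (q :: L') ≤ bcdLen y + xLength L ∧
      (wordWeight (q :: L') + if Even k ∧ L ≠ [] then 3 else 0) ≤ triWeight y + wordWeight L := by
  cases L with
  | nil =>
    exact ⟨(y, k), [], trivial, by simp [wordEval], by simp [aLength], by simp [xLength],
      by simp [wordWeight]⟩
  | cons p L =>
    by_cases hk : Even k
    · obtain ⟨q, h1, h2, h3, h4, h5⟩ := exists_merge hk y p hL
      exact ⟨q, L, h1, h2, h3, h4, by simpa [hk] using h5⟩
    · exact ⟨(y, k), p :: L, ⟨Int.not_even_iff_odd.1 hk, hL⟩, rfl, by simp [aLength],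
        by simp [xLength], by simp [wordWeight, hk]⟩

/-- The sections of an alternating word. -/
theorem exists_sections (p : Syllable) (L : List Syllable) (hL : Alternates (p :: L)) :
    ∃ (q : Syllable) (L₁ L₀ : List Syllable) (s : ℤ),
      Alternates (q :: L₁) ∧ Alternates L₀ ∧
      wordEval (p :: L) = vert (gmPerm .a ^ (p.1.1 + p.1.2.1) * wordEval L₀, wordEval (q :: L₁)) *
        gmPerm .a ^ s ∧
      s.natAbs ≤ aLength (p :: L) ∧
      (p.1.1 + p.1.2.1).natAbs + aLength L₀ + aLength (q :: L₁) ≤ xLength (p :: L) ∧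
      xLength L₀ + xLength (q :: L₁) ≤ xLength (p :: L) ∧
      6 * (wordWeight L₀ + wordWeight (q :: L₁)) ≤ 5 * wordWeight (p :: L) +
        (if Even (p.1.1 + p.1.2.1) then 18 else 0) + if L₀ = [] then 0 else 18 := by
  induction L generalizing p with
  | nil =>
    refine ⟨(rot p.1, 0), [], [], p.2, trivial, trivial, ?_, ?_, ?_, ?_, ?_⟩
    · simp [wordEval, bcd_eq_vert p.1]
    · simp [aLength]
    · simp [aLength, xLength, bcdLen]
      omega
    · simp [xLength, bcdLen_rot]
    · simpa [wordWeight] using triWeight_rot p.1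
  | cons p' L ih =>
    obtain ⟨q, L₁, L₀, s, h1, h2, h3, h4, h5, h6, h7⟩ := ih p' hL.2
    -- The odd power of `a` exchanges the sections of the rest: its even section, whose leading
    -- power of `a` was kept apart, is absorbed by the new odd section, while its odd section `q ::
    -- L₁` becomes the tail of the new even one.
    obtain ⟨q', L', g1, g2, g3, g4, g5⟩ := exists_prepend (rot p.1) (p'.1.1 + p'.1.2.1) h2
    refine ⟨q', L', q :: L₁, p.2 + s, g1, h1, ?_, ?_, ?_, ?_, ?_⟩
    · rw [wordEval, h3, ← g2, bcd_eq_vert p.1, mul_assoc, ← mul_assoc (gmPerm .a ^ p.2),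
        a_mul_vert_of_odd hL.1, mul_assoc (vert _) (gmPerm .a ^ p.2), ← zpow_add, ← mul_assoc,
        ← map_mul]
      simp only [Prod.mk_mul_mk, mul_assoc]
    · rw [aLength]
      omega
    · rw [xLength_cons p]
      have : (p.1.1 + p.1.2.1).natAbs ≤ bcdLen p.1 := by
        simp only [bcdLen]
        omega
      omega
    · rw [xLength_cons p]
      rw [bcdLen_rot] at g4
      omega
    · rw [wordWeight_cons p]
      have := triWeight_rot p.1
      have e : (q :: L₁) ≠ [] := by simp
      rw [if_neg e]
      -- When `L₀ = []` there is nothing to merge with, so the pending `18` is not repaid and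
      -- becomes the last term of the bound. This happens only at the right end of the word;
      -- elsewhere an even junction repays it.
      by_cases h8 : L₀ = []
      · subst h8
        simp only [ne_eq, not_true_eq_false, and_false, if_false, if_true] at g5 h7
        split_ifs at h7 this ⊢ <;> omega
      · by_cases h9 : Even (p'.1.1 + p'.1.2.1)
        · rw [if_pos ⟨h9, h8⟩] at g5
          rw [if_neg h8, if_pos h9] at h7
          omega
        · rw [if_neg (fun h => h9 h.1)] at g5
          rw [if_neg h8, if_neg h9] at h7
          omega

/-- The elements represented by an alternating word whose total exponent of `a` is at most `A`,
whose total exponent of `b`, `c`, `d` is at most `X`, and whose weight is at most `W`. -/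
def altBall (A X W : ℕ) : Set (Equiv.Perm (ℕ → ℤ)) :=
  {g | ∃ (k : ℤ) (L : List Syllable), Alternates L ∧ g = gmPerm .a ^ k * wordEval L ∧
    k.natAbs + aLength L ≤ A ∧ xLength L ≤ X ∧ wordWeight L ≤ W}

/-- Contraction: the elements of a ball are determined by an integer and by two elements of
balls whose total weight is smaller. -/
theorem exists_vert_of_mem_altBall {A X W : ℕ} {g : Equiv.Perm (ℕ → ℤ)} (hg : g ∈ altBall A X W) :
    ∃ (s : ℤ) (A₀ A₁ X₀ X₁ W₀ W₁ : ℕ) (g₀ g₁ : Equiv.Perm (ℕ → ℤ)),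
      g = vert (g₀, g₁) * gmPerm .a ^ s ∧ g₀ ∈ altBall A₀ X₀ W₀ ∧ g₁ ∈ altBall A₁ X₁ W₁ ∧
      s.natAbs ≤ A ∧ A₀ + A₁ ≤ X ∧ X₀ + X₁ ≤ X ∧ 6 * (W₀ + W₁) ≤ 5 * W + 36 := by
  obtain ⟨k, L, hL, rfl, hA, hX, hW⟩ := hg
  cases L with
  | nil =>
    refine ⟨k, 0, 0, 0, 0, 0, 0, 1, 1, ?_, ?_, ?_, ?_, by omega, by omega, by omega⟩
    · have : ((1 : Equiv.Perm (ℕ → ℤ)), (1 : Equiv.Perm (ℕ → ℤ))) = 1 := rfl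
      simp [wordEval, this]
    · exact ⟨0, [], trivial, by simp [wordEval], by simp [aLength], by simp [xLength],
        by simp [wordWeight]⟩
    · exact ⟨0, [], trivial, by simp [wordEval], by simp [aLength], by simp [xLength],
        by simp [wordWeight]⟩
    · omega
  | cons p L =>
    obtain ⟨q, L₁, L₀, s, h1, h2, h3, h4, h5, h6, h7⟩ := exists_sections p L hL
    have h8 : 6 * (wordWeight L₀ + wordWeight (q :: L₁)) ≤ 5 * W + 36 := by
      split_ifs at h7 <;> omega
    have m0 : gmPerm .a ^ (p.1.1 + p.1.2.1) * wordEval L₀ ∈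
        altBall ((p.1.1 + p.1.2.1).natAbs + aLength L₀) (xLength L₀) (wordWeight L₀) :=
      ⟨_, L₀, h2, rfl, le_rfl, le_rfl, le_rfl⟩
    have m1 : wordEval (q :: L₁) ∈
        altBall (aLength (q :: L₁)) (xLength (q :: L₁)) (wordWeight (q :: L₁)) :=
      ⟨0, q :: L₁, h1, by simp, by simp, le_rfl, le_rfl⟩
    rcases Int.even_or_odd k with hk | hk
    · refine ⟨k + s, _, _, _, _, _, _, _, _, ?_, m0, m1, by omega, by omega, by omega, h8⟩
      rw [h3, ← mul_assoc, a_mul_vert_of_even hk, mul_assoc, zpow_add _ k]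
    · refine ⟨k + s, _, _, _, _, _, _, _, _, ?_, m1, m0, by omega, by omega, by omega, by omega⟩
      rw [h3, ← mul_assoc, a_mul_vert_of_odd hk, mul_assoc, zpow_add _ k]

theorem mul_mem_altBall {A X W : ℕ} {g s : Equiv.Perm (ℕ → ℤ)}
    (hs : s ∈ gmGenerators ∨ s⁻¹ ∈ gmGenerators)
    (hg : g ∈ altBall A X W) : s * g ∈ altBall (A + 1) (X + 1) (W + 6) := by
  obtain ⟨k, L, hL, rfl, hA, hX, hW⟩ := hg
  have key : (∃ j : ℤ, j.natAbs ≤ 1 ∧ s = gmPerm .a ^ j) ∨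
      ∃ y : ℤ × ℤ × ℤ, bcdLen y ≤ 1 ∧ s = bcd y := by
    have aux : ∀ {j : ℤ} {t : GMLabel}, j.natAbs ≤ 1 → t ≠ .one → s = gmPerm t ^ j →
        (∃ j : ℤ, j.natAbs ≤ 1 ∧ s = gmPerm .a ^ j) ∨
        ∃ y : ℤ × ℤ × ℤ, bcdLen y ≤ 1 ∧ s = bcd y := by
      intro j t hj ht h
      cases t with
      | one => exact absurd rfl ht
      | a => exact Or.inl ⟨j, hj, h⟩
      | b => exact Or.inr ⟨(j, 0, 0), by simpa [bcdLen] using hj, by simp [bcd, h]⟩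
      | c => exact Or.inr ⟨(0, j, 0), by simpa [bcdLen] using hj, by simp [bcd, h]⟩
      | d => exact Or.inr ⟨(0, 0, j), by simpa [bcdLen] using hj, by simp [bcd, h]⟩
    rcases hs with hs | hs
    · rcases hs with rfl | rfl | rfl | rfl <;>
        exact aux (j := 1) (by simp) (by simp) (zpow_one _).symm
    · rcases hs with h | h | h | h <;>
      · replace h := inv_eq_iff_eq_inv.1 h
        refine aux (j := -1) (by simp) ?_ (h.trans (zpow_neg_one _).symm)
        simp
  rcases key with ⟨j, hj, rfl⟩ | ⟨y, hy, rfl⟩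
  · exact ⟨j + k, L, hL, by rw [zpow_add, mul_assoc], by omega, by omega, by omega⟩
  · obtain ⟨q, L', h1, h2, h3, h4, h5⟩ := exists_prepend y k hL
    have := triWeight_le_six y
    refine ⟨0, q :: L', h1, ?_, ?_, ?_, ?_⟩
    · rw [← h2, zpow_zero, one_mul, mul_assoc]
    · simp only [Int.natAbs_zero, zero_add]
      omega
    · omega
    · split_ifs at h5 <;> omega

theorem list_prod_mem_altBall (w : List (Equiv.Perm (ℕ → ℤ)))
    (hw : ∀ s ∈ w, s ∈ gmGenerators ∨ s⁻¹ ∈ gmGenerators) :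
    w.prod ∈ altBall w.length w.length (6 * w.length) := by
  induction w with
  | nil =>
    exact ⟨0, [], trivial, by simp [wordEval], by simp [aLength], by simp [xLength],
      by simp [wordWeight]⟩
  | cons s w ih =>
    rw [List.prod_cons]
    exact mul_mem_altBall (hw s (by simp)) (ih fun t ht => hw t (by simp [ht]))

/-! ### Subexponential growth -/

/-- Polynomial counting factors are absorbed by the arbitrarily small change of exponents allowed in
`GrowthBound`. -/
theorem exists_pow_le_exp {ε : ℝ} (hε : 0 < ε) (k : ℕ) :
    ∃ C : ℝ, 0 < C ∧ ∀ n : ℕ, ((n : ℝ) + 1) ^ k ≤ C * Real.exp (ε * n) := by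
  refine ⟨k.factorial * Real.exp ε / ε ^ k, by positivity, fun n => ?_⟩
  have h := Real.pow_div_factorial_le_exp (ε * (n + 1)) (by positivity) k
  rw [div_le_iff₀ (by positivity), mul_pow] at h
  rw [div_mul_eq_mul_div, le_div_iff₀ (by positivity)]
  calc ((n : ℝ) + 1) ^ k * ε ^ k = ε ^ k * (n + 1) ^ k := mul_comm _ _
    _ ≤ _ := h
    _ = _ := by
      rw [mul_assoc, ← Real.exp_add]
      ring_nf

/-- The balls `altBall A X W` have at most `C * exp (α * A + ξ * X + β * W)` elements, up to an
arbitrarily small change of the exponents. -/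
def GrowthBound (α ξ β : ℝ) : Prop :=
  ∀ ε : ℝ, 0 < ε → ∃ C : ℝ, 0 < C ∧ ∀ A X W : ℕ, ∃ F : Finset (Equiv.Perm (ℕ → ℤ)),
    altBall A X W ⊆ F ∧
      (F.card : ℝ) ≤ C * Real.exp ((α + ε) * A + (ξ + ε) * X + (β + ε) * W)

theorem card_Icc_neg (A : ℕ) : (Finset.Icc (-(A : ℤ)) A).card = 2 * A + 1 := by
  rw [Int.card_Icc]
  omega

-- An element is determined by its translation `s`, with `2 * A + 1` values, and its two sections.
-- The number of ways of sharing the parameters between the sections is polynomial. The product of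
-- the two bounds has total `a`-length at most `X`, total `bcd`-length at most `X`, and total weight
-- at most `5/6 * W + 6`.
open Classical in
theorem GrowthBound.contract {α ξ β : ℝ} (hα : 0 ≤ α) (hξ : 0 ≤ ξ) (hβ : 0 ≤ β)
    (h : GrowthBound α ξ β) : GrowthBound 0 (α + ξ) (5 / 6 * β) := by
  intro ε hε
  obtain ⟨C, hC, H⟩ := h (ε / 4) (by positivity)
  choose F hF hcard using H
  obtain ⟨C₁, hC₁, h₁⟩ := exists_pow_le_exp hε 1
  obtain ⟨C₂, hC₂, h₂⟩ := exists_pow_le_exp (half_pos hε) 4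
  obtain ⟨C₃, hC₃, h₃⟩ := exists_pow_le_exp (half_pos hε) 2
  refine ⟨(2 * C₁) * (C₂ * (49 * C₃)) * (C ^ 2 * Real.exp (6 * (β + ε / 4))), by positivity,
    fun A X W => ?_⟩
  -- The possible parameters `((A₀, A₁), (X₀, X₁)), (W₀, W₁)`. Since `W₀ + W₁ ≤ (5 * W + 36) / 6`,
  -- each weight is at most `W + 6`, hence the range `W + 7`.
  let idx : Finset (((ℕ × ℕ) × (ℕ × ℕ)) × (ℕ × ℕ)) :=
    (((Finset.range (X + 1) ×ˢ Finset.range (X + 1)) ×ˢ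
      (Finset.range (X + 1) ×ˢ Finset.range (X + 1))) ×ˢ
      (Finset.range (W + 7) ×ˢ Finset.range (W + 7))).filter fun i =>
        (i.1.1.1 + i.1.1.2 ≤ X ∧ i.1.2.1 + i.1.2.2 ≤ X) ∧ 6 * (i.2.1 + i.2.2) ≤ 5 * W + 36
  let T : Finset (Equiv.Perm (ℕ → ℤ) × Equiv.Perm (ℕ → ℤ)) :=
    idx.biUnion fun i => F i.1.1.1 i.1.2.1 i.2.1 ×ˢ F i.1.1.2 i.1.2.2 i.2.2
  refine ⟨(Finset.Icc (-(A : ℤ)) A ×ˢ T).image fun p => vert p.2 * gmPerm .a ^ p.1, ?_, ?_⟩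
  · intro g hg
    obtain ⟨s, A₀, A₁, X₀, X₁, W₀, W₁, g₀, g₁, rfl, h0, h1, hs, hA, hX, hW⟩ :=
      exists_vert_of_mem_altBall hg
    simp only [Finset.coe_image, Set.mem_image]
    refine ⟨(s, g₀, g₁), ?_, rfl⟩
    simp only [Finset.coe_product, Set.mem_prod, Finset.mem_coe, Finset.mem_Icc, T,
      Finset.mem_biUnion, Finset.mem_product, idx, Finset.mem_filter, Finset.mem_range]
    exact ⟨by omega, (((A₀, A₁), (X₀, X₁)), (W₀, W₁)),
      ⟨⟨⟨⟨by dsimp; omega, by dsimp; omega⟩, ⟨by dsimp; omega, by dsimp; omega⟩⟩,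
        ⟨by dsimp; omega, by dsimp; omega⟩⟩, ⟨hA, hX⟩, hW⟩, hF _ _ _ h0, hF _ _ _ h1⟩
  · have hidx : (idx.card : ℝ) ≤ ((X : ℝ) + 1) ^ 4 * (49 * ((W : ℝ) + 1) ^ 2) := by
      have : (idx.card : ℝ) ≤ ((X : ℝ) + 1) ^ 4 * ((W : ℝ) + 7) ^ 2 := by
        have h := Finset.card_filter_le (((Finset.range (X + 1) ×ˢ Finset.range (X + 1)) ×ˢ
          (Finset.range (X + 1) ×ˢ Finset.range (X + 1))) ×ˢ
          (Finset.range (W + 7) ×ˢ Finset.range (W + 7))) fun i =>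
          (i.1.1.1 + i.1.1.2 ≤ X ∧ i.1.2.1 + i.1.2.2 ≤ X) ∧ 6 * (i.2.1 + i.2.2) ≤ 5 * W + 36
        simp only [Finset.card_product, Finset.card_range] at h
        calc (idx.card : ℝ) ≤ (((X + 1) * (X + 1) * ((X + 1) * (X + 1)) *
              ((W + 7) * (W + 7)) : ℕ) : ℝ) := by exact_mod_cast h
          _ = _ := by push_cast; ring
      refine this.trans ?_
      gcongr
      nlinarith [(Nat.cast_nonneg W : (0 : ℝ) ≤ W)]
    have hterm : ∀ i ∈ idx, (((F i.1.1.1 i.1.2.1 i.2.1 ×ˢ F i.1.1.2 i.1.2.2 i.2.2).card : ℕ) : ℝ) ≤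
        C ^ 2 * Real.exp ((α + ε / 4) * (i.1.1.1 + i.1.1.2) + (ξ + ε / 4) * (i.1.2.1 + i.1.2.2) +
          (β + ε / 4) * (i.2.1 + i.2.2)) := by
      intro i hi
      rw [Finset.card_product, Nat.cast_mul]
      refine (mul_le_mul (hcard _ _ _) (hcard _ _ _) (by positivity) (by positivity)).trans_eq ?_
      rw [mul_mul_mul_comm, ← Real.exp_add, sq]
      ring_nf
    have hterm' : ∀ i ∈ idx, (((F i.1.1.1 i.1.2.1 i.2.1 ×ˢ F i.1.1.2 i.1.2.2 i.2.2).card : ℕ) : ℝ) ≤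
        C ^ 2 * Real.exp ((α + ε / 4) * X + (ξ + ε / 4) * X +
          (β + ε / 4) * ((5 * W + 36) / 6)) := by
      intro i hi
      refine (hterm i hi).trans ?_
      obtain ⟨-, ⟨h1, h2⟩, h3⟩ := Finset.mem_filter.1 hi
      have h1' : (i.1.1.1 : ℝ) + i.1.1.2 ≤ X := by exact_mod_cast h1
      have h2' : (i.1.2.1 : ℝ) + i.1.2.2 ≤ X := by exact_mod_cast h2
      have h3' : (6 : ℝ) * (i.2.1 + i.2.2) ≤ 5 * W + 36 := by exact_mod_cast h3
      gcongr
      linarith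
    have hT : (T.card : ℝ) ≤ idx.card * (C ^ 2 * Real.exp ((α + ε / 4) * X + (ξ + ε / 4) * X +
          (β + ε / 4) * ((5 * W + 36) / 6))) := by
      calc (T.card : ℝ) ≤ ((∑ i ∈ idx, (F i.1.1.1 i.1.2.1 i.2.1 ×ˢ
            F i.1.1.2 i.1.2.2 i.2.2).card : ℕ) : ℝ) := by
            exact_mod_cast Finset.card_biUnion_le
        _ ≤ _ := by
          rw [Nat.cast_sum, ← nsmul_eq_mul]
          exact Finset.sum_le_card_nsmul _ _ _ hterm'
    have hA : (((Finset.Icc (-(A : ℤ)) A).card : ℕ) : ℝ) ≤ 2 * (C₁ * Real.exp (ε * A)) := by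
      rw [card_Icc_neg]
      have := h₁ A
      push_cast
      have hA0 : (0 : ℝ) ≤ A := Nat.cast_nonneg A
      linarith
    have hXW : (idx.card : ℝ) ≤ (C₂ * Real.exp (ε / 2 * X)) * (49 * (C₃ * Real.exp (ε / 2 * W))) := by
      refine hidx.trans ?_
      gcongr
      · exact h₂ X
      · exact h₃ W
    calc _ ≤ (((Finset.Icc (-(A : ℤ)) A ×ˢ T).card : ℕ) : ℝ) := by
          exact_mod_cast Finset.card_image_le
      _ = ((Finset.Icc (-(A : ℤ)) A).card : ℝ) * (T.card : ℝ) := by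
          rw [Finset.card_product, Nat.cast_mul]
      _ ≤ (2 * (C₁ * Real.exp (ε * A))) * (((C₂ * Real.exp (ε / 2 * X)) *
            (49 * (C₃ * Real.exp (ε / 2 * W)))) * (C ^ 2 * Real.exp ((α + ε / 4) * X +
            (ξ + ε / 4) * X + (β + ε / 4) * ((5 * W + 36) / 6)))) := by
          refine mul_le_mul hA (hT.trans ?_) (by positivity) (by positivity)
          gcongr
      _ = (2 * C₁) * (C₂ * (49 * C₃)) * C ^ 2 * (Real.exp (ε * A) * (Real.exp (ε / 2 * X) *
            Real.exp (ε / 2 * W) * Real.exp ((α + ε / 4) * X +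
            (ξ + ε / 4) * X + (β + ε / 4) * ((5 * W + 36) / 6)))) := by ring
      _ ≤ (2 * C₁) * (C₂ * (49 * C₃)) * C ^ 2 * (Real.exp (6 * (β + ε / 4)) *
            Real.exp ((0 + ε) * A + (α + ξ + ε) * X + (5 / 6 * β + ε) * W)) := by
          rw [← Real.exp_add, ← Real.exp_add, ← Real.exp_add, ← Real.exp_add]
          refine mul_le_mul_of_nonneg_left (Real.exp_le_exp.2 ?_) (by positivity)
          have hW0 : (0 : ℝ) ≤ W := Nat.cast_nonneg W
          nlinarith [mul_nonneg hε.le hW0]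
      _ = _ := by ring

/-- The number of letters of a syllable. -/
def syllableCost (p : Syllable) : ℕ := p.2.natAbs + bcdLen p.1

theorem summable_exp_neg_natAbs {α : ℝ} (hα : 0 < α) :
    Summable fun k : ℤ => Real.exp (-α * (k.natAbs : ℝ)) := by
  have h : Summable fun n : ℕ => Real.exp (-α * (n : ℝ)) := by
    have := summable_geometric_of_lt_one (Real.exp_pos (-α)).le
      (Real.exp_lt_one_iff.2 (neg_neg_of_pos hα))
    refine this.congr fun n => ?_
    rw [← Real.exp_nat_mul, mul_comm]
  refine Summable.of_nat_of_neg ?_ ?_ <;> simpa using h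

theorem summable_exp_neg_syllableCost {α : ℝ} (hα : 0 < α) :
    Summable fun p : Syllable => Real.exp (-α * (syllableCost p : ℝ)) := by
  have h := summable_exp_neg_natAbs hα
  have hpos : 0 ≤ fun k : ℤ => Real.exp (-α * (k.natAbs : ℝ)) := fun k => (Real.exp_pos _).le
  have h2 := h.mul_of_nonneg h hpos hpos
  have h3 := h.mul_of_nonneg h2 hpos fun p => by positivity
  have h4 := h3.mul_of_nonneg h (fun p => by positivity) hpos
  refine h4.congr fun p => ?_
  simp only [← Real.exp_add, syllableCost, bcdLen]
  push_cast
  ring_nf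

-- A Chernoff-type bound: weighting each letter by `exp (-α)`, a word of cost at most `N` has weight
-- at least `exp (-α * N)`, while words of `r` syllables have total weight at most `S ^ r`.
open Classical in
theorem exists_cover_words {α S : ℝ} (hα : 0 ≤ α) (hS : 0 ≤ S)
    (hsum : ∀ T : Finset Syllable, ∑ p ∈ T, Real.exp (-α * (syllableCost p : ℝ)) ≤ S) (r : ℕ) :
    ∀ N : ℕ, ∃ F : Finset (List Syllable),
      (∀ L : List Syllable, L.length = r → aLength L + xLength L ≤ N → L ∈ F) ∧
      (F.card : ℝ) ≤ S ^ r * Real.exp (α * N) := by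
  induction r with
  | zero =>
    intro N
    refine ⟨{[]}, fun L hL _ => by simpa using hL, ?_⟩
    simpa using mul_nonneg hα (Nat.cast_nonneg N)
  | succ r ih =>
    intro N
    choose F hF hcard using ih
    let I : Finset ℤ := Finset.Icc (-(N : ℤ)) N
    let box : Finset Syllable := ((I ×ˢ (I ×ˢ I)) ×ˢ I).filter fun p => syllableCost p ≤ N
    refine ⟨box.biUnion fun p => (F (N - syllableCost p)).image (List.cons p), ?_, ?_⟩
    · intro L hL hN
      cases L with
      | nil => simp at hL
      | cons p L =>
        simp only [Finset.mem_biUnion, Finset.mem_image]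
        simp only [aLength, xLength] at hN
        refine ⟨p, ?_, L, hF _ L (by simpa using hL) ?_, rfl⟩
        · simp only [bcdLen] at hN
          refine Finset.mem_filter.2 ⟨?_, by simp only [syllableCost, bcdLen]; omega⟩
          simp only [I, Finset.mem_product, Finset.mem_Icc]
          omega
        · simp only [syllableCost]
          omega
    · have h1 : ∀ p ∈ box, (((F (N - syllableCost p)).image (List.cons p)).card : ℝ) ≤
          S ^ r * Real.exp (α * N) * Real.exp (-α * (syllableCost p : ℝ)) := by
        intro p hp
        have hp' := (Finset.mem_filter.1 hp).2
        calc (((F (N - syllableCost p)).image (List.cons p)).card : ℝ)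
            ≤ ((F (N - syllableCost p)).card : ℝ) := by exact_mod_cast Finset.card_image_le
          _ ≤ _ := hcard _
          _ = _ := by
            rw [mul_assoc, ← Real.exp_add, Nat.cast_sub hp']
            ring_nf
      calc _ ≤ ((∑ p ∈ box, ((F (N - syllableCost p)).image (List.cons p)).card : ℕ) : ℝ) := by
            exact_mod_cast Finset.card_biUnion_le
        _ ≤ ∑ p ∈ box, S ^ r * Real.exp (α * N) * Real.exp (-α * (syllableCost p : ℝ)) := by
            rw [Nat.cast_sum]
            exact Finset.sum_le_sum h1
        _ ≤ S ^ r * Real.exp (α * N) * S := by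
            rw [← Finset.mul_sum]
            gcongr
            exact hsum box
        _ = _ := by ring

-- Each syllable has weight at least `4`, so a word has at most `W` syllables and the rate `β = log
-- S` suffices. The rate `β` may be huge when `α` is small.
open Classical in
theorem exists_growthBound {α : ℝ} (hα : 0 < α) : ∃ β : ℝ, 0 ≤ β ∧ GrowthBound α α β := by
  have hs := summable_exp_neg_syllableCost hα
  -- The added `1` gives `S ≥ 1`, so that `S ^ r ≤ S ^ W` for `r ≤ W` and `log S ≥ 0`.
  set S : ℝ := 1 + ∑' p : Syllable, Real.exp (-α * (syllableCost p : ℝ)) with hS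
  have htsum : 0 ≤ ∑' p : Syllable, Real.exp (-α * (syllableCost p : ℝ)) :=
    tsum_nonneg fun p => (Real.exp_pos _).le
  have hS1 : 1 ≤ S := by linarith
  have hS0 : 0 < S := by linarith
  have hsum : ∀ T : Finset Syllable, ∑ p ∈ T, Real.exp (-α * (syllableCost p : ℝ)) ≤ S := by
    intro T
    have := hs.sum_le_tsum T fun p _ => (Real.exp_pos _).le
    linarith
  refine ⟨Real.log S, Real.log_nonneg hS1, fun ε hε => ?_⟩
  obtain ⟨C₁, hC₁, h₁⟩ := exists_pow_le_exp hε 1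
  refine ⟨2 * C₁ * C₁, by positivity, fun A X W => ?_⟩
  choose F hF hcard using fun r => exists_cover_words hα.le hS0.le hsum r (A + X)
  refine ⟨(Finset.Icc (-(A : ℤ)) A ×ˢ (Finset.range (W + 1)).biUnion F).image
    fun p => gmPerm .a ^ p.1 * wordEval p.2, ?_, ?_⟩
  · rintro g ⟨k, L, -, rfl, hA, hX, hW⟩
    have hlen : ∀ L : List Syllable, L.length ≤ wordWeight L := by
      intro L
      induction L with
      | nil => simp
      | cons p L ih =>
        have := four_le_triWeight p.1
        rw [wordWeight_cons, List.length_cons]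
        omega
    have := hlen L
    simp only [Finset.coe_image, Set.mem_image]
    refine ⟨(k, L), ?_, rfl⟩
    simp only [Finset.coe_product, Set.mem_prod, Finset.mem_coe, Finset.mem_Icc,
      Finset.mem_biUnion, Finset.mem_range]
    exact ⟨by omega, L.length, by omega, hF _ L rfl (by omega)⟩
  · have hA : (((Finset.Icc (-(A : ℤ)) A).card : ℕ) : ℝ) ≤ 2 * (C₁ * Real.exp (ε * A)) := by
      rw [card_Icc_neg]
      have := h₁ A
      push_cast
      have hA0 : (0 : ℝ) ≤ A := Nat.cast_nonneg A
      linarith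
    have hU : ((((Finset.range (W + 1)).biUnion F).card : ℕ) : ℝ) ≤
        (C₁ * Real.exp (ε * W)) * (Real.exp (Real.log S * W) * Real.exp (α * (A + X))) := by
      calc ((((Finset.range (W + 1)).biUnion F).card : ℕ) : ℝ)
          ≤ ((∑ r ∈ Finset.range (W + 1), (F r).card : ℕ) : ℝ) := by
            exact_mod_cast Finset.card_biUnion_le
        _ ≤ ∑ r ∈ Finset.range (W + 1), S ^ W * Real.exp (α * (A + X)) := by
            rw [Nat.cast_sum]
            refine Finset.sum_le_sum fun r hr => (hcard r).trans ?_
            push_cast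
            have : r ≤ W := by
              have := Finset.mem_range.1 hr
              omega
            gcongr
        _ = ((W : ℝ) + 1) ^ 1 * (S ^ W * Real.exp (α * (A + X))) := by
            rw [Finset.sum_const, Finset.card_range, nsmul_eq_mul]
            push_cast
            ring
        _ ≤ _ := by
            have e : Real.exp (Real.log S * W) = S ^ W := by
              rw [mul_comm, Real.exp_nat_mul, Real.exp_log hS0]
            rw [e]
            gcongr
            exact h₁ W
    calc _ ≤ (((Finset.Icc (-(A : ℤ)) A ×ˢ (Finset.range (W + 1)).biUnion F).card : ℕ) : ℝ) := by
          exact_mod_cast Finset.card_image_le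
      _ = ((Finset.Icc (-(A : ℤ)) A).card : ℝ) *
            (((Finset.range (W + 1)).biUnion F).card : ℝ) := by
          rw [Finset.card_product, Nat.cast_mul]
      _ ≤ (2 * (C₁ * Real.exp (ε * A))) * ((C₁ * Real.exp (ε * W)) *
            (Real.exp (Real.log S * W) * Real.exp (α * (A + X)))) :=
          mul_le_mul hA hU (by positivity) (by positivity)
      _ = 2 * C₁ * C₁ * (Real.exp (ε * A) * (Real.exp (ε * W) *
            (Real.exp (Real.log S * W) * Real.exp (α * (A + X))))) := by ring
      _ ≤ _ := by
          rw [← Real.exp_add, ← Real.exp_add, ← Real.exp_add]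
          refine mul_le_mul_of_nonneg_left (Real.exp_le_exp.2 ?_) (by positivity)
          have hX0 : (0 : ℝ) ≤ X := Nat.cast_nonneg X
          nlinarith [mul_nonneg hε.le hX0]

/-- The first contraction moves the rate of `a` onto `b`, `c`, `d`, giving `ε / 4 + ε / 4`. Later
contractions leave this rate unchanged and multiply that of the weight by `5/6`. -/
theorem growthBound_zero : GrowthBound 0 0 0 := by
  intro ε hε
  obtain ⟨β, hβ, h⟩ := exists_growthBound (α := ε / 4) (by positivity)
  have hk : ∀ k : ℕ, GrowthBound 0 (ε / 4 + ε / 4) ((5 / 6) ^ k * (5 / 6 * β)) := by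
    intro k
    induction k with
    | zero => simpa using h.contract (by positivity) (by positivity) hβ
    | succ k ih =>
      have := ih.contract le_rfl (by positivity) (by positivity)
      rwa [zero_add, ← mul_assoc, ← pow_succ'] at this
  have hlim : Tendsto (fun k : ℕ => ((5 : ℝ) / 6) ^ k * (5 / 6 * β)) atTop (𝓝 (0 * (5 / 6 * β))) :=
    (tendsto_pow_atTop_nhds_zero_of_lt_one (by norm_num) (by norm_num)).mul_const _
  rw [zero_mul] at hlim
  obtain ⟨k, hk'⟩ := (hlim.eventually (gt_mem_nhds (half_pos hε))).exists
  obtain ⟨C, hC, H⟩ := hk k (ε / 2) (by positivity)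
  refine ⟨C, hC, fun A X W => ?_⟩
  obtain ⟨F, hF, hcard⟩ := H A X W
  refine ⟨F, hF, hcard.trans (mul_le_mul_of_nonneg_left (Real.exp_le_exp.2 ?_) hC.le)⟩
  refine add_le_add (add_le_add ?_ ?_) ?_ <;>
    exact mul_le_mul_of_nonneg_right (by linarith) (Nat.cast_nonneg _)

theorem altBall_mono {A X W A' X' W' : ℕ} (hA : A ≤ A') (hX : X ≤ X') (hW : W ≤ W') :
    altBall A X W ⊆ altBall A' X' W' := by
  rintro g ⟨k, L, h1, h2, h3, h4, h5⟩
  exact ⟨k, L, h1, h2, h3.trans hA, h4.trans hX, h5.trans hW⟩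

theorem exists_list_of_mem {g : Equiv.Perm (ℕ → ℤ)} (hg : g ∈ grigorchukMaki) :
    ∃ w : List (Equiv.Perm (ℕ → ℤ)), (∀ s ∈ w, s ∈ gmGenerators ∨ s⁻¹ ∈ gmGenerators) ∧
      w.prod = g := by
  rw [grigorchukMaki, ← Subgroup.mem_toSubmonoid, Subgroup.closure_toSubmonoid] at hg
  obtain ⟨w, hw, h⟩ := Submonoid.exists_list_of_mem_closure hg
  exact ⟨w, fun s hs => by simpa using hw s hs, h⟩

/-- The balls of a finitely generated group of the form `f⁻¹(grigorchukMaki)`, seen through `f`. -/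
theorem exists_mul_le_mem_altBall {G : Type*} [Group G] (f : G →* Equiv.Perm (ℕ → ℤ))
    (hf : ∀ g, f g ∈ grigorchukMaki) (S : Finset G) :
    ∃ K : ℕ, ∀ (n : ℕ) (w : List G), w.length ≤ n → (∀ s ∈ w, s ∈ S) →
      f w.prod ∈ altBall (K * n) (K * n) (6 * (K * n)) := by
  choose w hw hprod using fun g => exists_list_of_mem (hf g)
  refine ⟨S.sup fun g => (w g).length, fun n v hv hS => ?_⟩
  have key : ∀ v : List G, (∀ s ∈ v, s ∈ S) → ∃ u : List (Equiv.Perm (ℕ → ℤ)),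
      (∀ s ∈ u, s ∈ gmGenerators ∨ s⁻¹ ∈ gmGenerators) ∧ u.prod = f v.prod ∧
      u.length ≤ (S.sup fun g => (w g).length) * v.length := by
    intro v
    induction v with
    | nil => exact fun _ => ⟨[], by simp, by simp, by simp⟩
    | cons g v ih =>
      intro h
      obtain ⟨u, h1, h2, h3⟩ := ih fun s hs => h s (by simp [hs])
      refine ⟨w g ++ u, ?_, by simp [h2, hprod], ?_⟩
      · intro s hs
        rcases List.mem_append.1 hs with hs | hs
        · exact hw g s hs
        · exact h1 s hs
      · have : (w g).length ≤ S.sup fun g => (w g).length :=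
          Finset.le_sup (f := fun g => (w g).length) (h g (by simp))
        rw [List.length_append, List.length_cons, mul_add, mul_one]
        omega
  obtain ⟨u, h1, h2, h3⟩ := key v hS
  have h4 : u.length ≤ (S.sup fun g => (w g).length) * n := h3.trans (Nat.mul_le_mul_left _ hv)
  rw [← h2]
  exact altBall_mono h4 h4 (by omega) (list_prod_mem_altBall u h1)

/-- A group that embeds in the Grigorchuk–Maki group has subexponential growth. -/
theorem tendsto_growthFunction_div_pow {G : Type*} [Group G] (f : G →* Equiv.Perm (ℕ → ℤ))
    (hinj : Function.Injective f) (hf : ∀ g, f g ∈ grigorchukMaki) (S : Finset G) {c : ℝ}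
    (hc : 1 < c) : Tendsto (fun n : ℕ => (growthFunction S n : ℝ) / c ^ n) atTop (𝓝 0) := by
  obtain ⟨K, hK⟩ := exists_mul_le_mem_altBall f hf S
  have hlog : 0 < Real.log c := Real.log_pos hc
  -- The parameters `K * n`, `K * n`, `6 * (K * n)` add up to `8 * K * n`, so this `ε` gives a
  -- growth rate of at most `log c / 2`.
  set ε : ℝ := Real.log c / (16 * (K + 1)) with hε
  have hε0 : 0 < ε := by positivity
  obtain ⟨C, hC, H⟩ := growthBound_zero ε hε0
  have hbound : ∀ n : ℕ, (growthFunction S n : ℝ) ≤ C * Real.exp (Real.log c / 2 * n) := by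
    intro n
    obtain ⟨F, hF, hcard⟩ := H (K * n) (K * n) (6 * (K * n))
    have h1 : growthFunction S n ≤ F.card := by
      rw [growthFunction, ← Set.ncard_image_of_injective _ hinj, ← Set.ncard_coe_finset F]
      refine Set.ncard_le_ncard ?_ F.finite_toSet
      rintro _ ⟨g, ⟨w, hw, hS, rfl⟩, rfl⟩
      exact hF (hK n w hw hS)
    have h2 : (growthFunction S n : ℝ) ≤ F.card := by exact_mod_cast h1
    refine (h2.trans hcard).trans ?_
    refine mul_le_mul_of_nonneg_left (Real.exp_le_exp.2 ?_) hC.le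
    push_cast
    have hn : (0 : ℝ) ≤ n := Nat.cast_nonneg n
    have hK0 : (0 : ℝ) ≤ K := Nat.cast_nonneg K
    have e : ε * (8 * (K + 1)) = Real.log c / 2 := by
      rw [hε]
      field_simp
      norm_num
    rw [← e]
    nlinarith [mul_nonneg hε0.le hn]
  have hlim : Tendsto (fun n : ℕ => C * Real.exp (-(Real.log c / 2)) ^ n) atTop (𝓝 (C * 0)) :=
    (tendsto_pow_atTop_nhds_zero_of_lt_one (Real.exp_pos _).le
      (Real.exp_lt_one_iff.2 (by linarith))).const_mul C
  rw [mul_zero] at hlim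
  refine squeeze_zero (fun n => by positivity) (fun n => ?_) hlim
  rw [div_le_iff₀ (by positivity)]
  refine (hbound n).trans_eq ?_
  have e : c ^ n = Real.exp (Real.log c * n) := by
    rw [mul_comm, Real.exp_nat_mul, Real.exp_log (by linarith)]
  rw [e, ← Real.exp_nat_mul, mul_assoc, ← Real.exp_add]
  ring_nf

/-! ### Superpolynomial growth -/

/-- The displacement of each entry only depends on the parities of the previous entries. -/
def IsTriangular (g : Equiv.Perm (ℕ → ℤ)) : Prop :=
  ∀ (n : ℕ) (l l' : ℕ → ℤ), (∀ j < n, Even (l j) ↔ Even (l' j)) → g l n - l n = g l' n - l' n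

theorem IsTriangular.even_iff {g : Equiv.Perm (ℕ → ℤ)} (hg : IsTriangular g) {n : ℕ}
    {l l' : ℕ → ℤ} (h : ∀ j < n, Even (l j) ↔ Even (l' j)) :
    ∀ j < n, Even (g l j) ↔ Even (g l' j) := by
  intro j hj
  have h1 := hg j l l' fun i hi => h i (hi.trans hj)
  have h2 := h j hj
  have e1 : g l j = (g l j - l j) + l j := by ring
  have e2 : g l' j = (g l j - l j) + l' j := by rw [h1]; ring
  rw [e1, e2, Int.even_add, Int.even_add, h2]

theorem isTriangular_gmPerm (s : GMLabel) : IsTriangular (gmPerm s) := by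
  intro n
  induction n generalizing s with
  | zero =>
    intro l l' _
    show l 0 + 1 * s.shift - l 0 = l' 0 + 1 * s.shift - l' 0
    ring
  | succ n ih =>
    intro l l' h
    have h0 := h 0 (Nat.succ_pos n)
    have hnext : s.next (l 0) = s.next (l' 0) := by
      cases s <;> simp [GMLabel.next, h0]
    have := ih (s.next (l 0)) (seqTail l) (seqTail l') fun j hj => h (j + 1) (by omega)
    show gmPerm (s.next (l 0)) (seqTail l) n - seqTail l n =
      gmPerm (s.next (l' 0)) (seqTail l') n - seqTail l' n
    rw [this, hnext]

theorem isTriangular_of_mem {g : Equiv.Perm (ℕ → ℤ)} (hg : g ∈ grigorchukMaki) :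
    IsTriangular g := by
  refine closure_induction ?_ isTriangular_gmPerm ?_ ?_ hg
  · intro n l l' _
    simp
  · intro g h hg hh n l l' H
    have h1 := hh n l l' H
    have h2 := hg n (h l) (h l') (hh.even_iff H)
    simp only [Equiv.Perm.mul_apply]
    linarith
  · intro g hg n
    induction n using Nat.strong_induction_on with
    | _ n ih =>
      intro l l' H
      have h1 : ∀ j < n, Even (g⁻¹ l j) ↔ Even (g⁻¹ l' j) := by
        intro j hj
        have h2 := ih j hj l l' fun i hi => H i (hi.trans hj)
        have e1 : g⁻¹ l j = (g⁻¹ l j - l j) + l j := by ring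
        have e2 : g⁻¹ l' j = (g⁻¹ l j - l j) + l' j := by rw [h2]; ring
        rw [e1, e2, Int.even_add, Int.even_add, H j hj]
      have h3 := hg n (g⁻¹ l) (g⁻¹ l') h1
      have e (l : ℕ → ℤ) : g (g⁻¹ l) = l := g.apply_symm_apply l
      rw [e, e] at h3
      linarith

/-- The group is self-replicating: `d`, `b`, `c` have odd sections `b`, `c`, `d`, and conjugating
`b` by `a` brings its even section `a` to the odd side. -/
theorem exists_vert_snd {h : Equiv.Perm (ℕ → ℤ)} (hh : h ∈ grigorchukMaki) :
    ∃ g, vert (g, h) ∈ grigorchukMaki := by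
  refine closure_induction (P := fun h => ∃ g, vert (g, h) ∈ grigorchukMaki) ?_ ?_ ?_ ?_ hh
  · refine ⟨1, ?_⟩
    have : ((1 : Equiv.Perm (ℕ → ℤ)), (1 : Equiv.Perm (ℕ → ℤ))) = 1 := rfl
    rw [this, map_one]
    exact one_mem _
  · intro s
    cases s with
    | one =>
      refine ⟨1, ?_⟩
      have : ((1 : Equiv.Perm (ℕ → ℤ)), (1 : Equiv.Perm (ℕ → ℤ))) = 1 := rfl
      rw [gmPerm_one, this, map_one]
      exact one_mem _
    | a =>
      refine ⟨gmPerm .c, ?_⟩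
      have h1 := a_mul_vert_of_odd (k := 1) odd_one (gmPerm .a) (gmPerm .c)
      rw [zpow_one, ← gmPerm_b_eq, ← mul_inv_eq_iff_eq_mul] at h1
      rw [← h1]
      exact mul_mem (mul_mem (gmPerm_mem _) (gmPerm_mem _)) (inv_mem (gmPerm_mem _))
    | b => exact ⟨1, gmPerm_d_eq ▸ gmPerm_mem .d⟩
    | c => exact ⟨gmPerm .a, gmPerm_b_eq ▸ gmPerm_mem .b⟩
    | d => exact ⟨gmPerm .a, gmPerm_c_eq ▸ gmPerm_mem .c⟩
  · rintro g h ⟨g', hg⟩ ⟨h', hh⟩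
    exact ⟨g' * h', by simpa [← map_mul] using mul_mem hg hh⟩
  · rintro g ⟨g', hg⟩
    exact ⟨g'⁻¹, by simpa [← map_inv] using inv_mem hg⟩

theorem exists_vert_fst {h : Equiv.Perm (ℕ → ℤ)} (hh : h ∈ grigorchukMaki) :
    ∃ g, vert (h, g) ∈ grigorchukMaki := by
  obtain ⟨g, hg⟩ := exists_vert_snd hh
  refine ⟨g, ?_⟩
  have h1 := a_mul_vert_of_odd (k := 1) odd_one g h
  rw [zpow_one, ← mul_inv_eq_iff_eq_mul] at h1
  rw [← h1]
  exact mul_mem (mul_mem (gmPerm_mem _) hg) (inv_mem (gmPerm_mem _))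

/-- The action on the parities of the first `n` entries is transitive. -/
theorem exists_even_iff (n : ℕ) : ∀ t t' : ℕ → ℤ, ∃ h ∈ grigorchukMaki, ∀ l : ℕ → ℤ,
    (∀ j < n, Even (l j) ↔ Even (t j)) → ∀ j < n, Even (h l j) ↔ Even (t' j) := by
  induction n with
  | zero => exact fun t t' => ⟨1, one_mem _, by simp⟩
  | succ n ih =>
    intro t t'
    obtain ⟨h, hh, H⟩ := ih (seqTail t) (seqTail t')
    have key : ∃ g ∈ grigorchukMaki, ∀ l : ℕ → ℤ, (Even (l 0) ↔ Even (t 0)) →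
        g l = seqCons (l 0) (h (seqTail l)) := by
      by_cases h0 : Even (t 0)
      · obtain ⟨g, hg⟩ := exists_vert_fst hh
        exact ⟨_, hg, fun l hl => by rw [vert_apply, if_pos (hl.2 h0)]⟩
      · obtain ⟨g, hg⟩ := exists_vert_snd hh
        exact ⟨_, hg, fun l hl => by rw [vert_apply, if_neg (fun h => h0 (hl.1 h))]⟩
    obtain ⟨g, hg, Hg⟩ := key
    refine ⟨gmPerm .a ^ (t' 0 - t 0) * g, mul_mem (zpow_mem (gmPerm_mem _) _) hg, ?_⟩
    intro l hl j hj
    rw [Equiv.Perm.mul_apply, Hg l (hl 0 (Nat.succ_pos n)), gmPerm_a_zpow]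
    cases j with
    | zero =>
      rw [seqCons_zero, Int.even_add, Int.even_sub, hl 0 (Nat.succ_pos n)]
      tauto
    | succ j =>
      rw [seqCons_succ]
      exact H (seqTail l) (fun i hi => hl (i + 1) (by omega)) j (by omega)

/-- The parities of the first `n` entries. -/
def parities (n : ℕ) (l : ℕ → ℤ) : Fin n → Bool := fun i => decide (Even (l i))

theorem parities_eq_iff {n : ℕ} {l l' : ℕ → ℤ} :
    parities n l = parities n l' ↔ ∀ j < n, Even (l j) ↔ Even (l' j) := by
  simp only [parities, funext_iff, decide_eq_decide]
  exact ⟨fun h j hj => h ⟨j, hj⟩, fun h j => h j j.2⟩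

theorem exists_parities_eq {n : ℕ} (t : Fin n → Bool) : ∃ l, parities n l = t := by
  refine ⟨fun j => if h : j < n then (if t ⟨j, h⟩ then 0 else 1) else 0, ?_⟩
  funext i
  cases h : t i <;> simp [parities, h]

/-- The permutation `g` preserves all parities, and translates the `n`-th entry by an amount
which is twice a function of the previous parities. -/
def TranslatesEntry (n : ℕ) (g : Equiv.Perm (ℕ → ℤ)) (f : (Fin n → Bool) → ℤ) : Prop :=
  (∀ l i, Even (g l i) ↔ Even (l i)) ∧ ∀ l, g l n = l n + 2 * f (parities n l)

theorem TranslatesEntry.one (n : ℕ) : TranslatesEntry n 1 0 :=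
  ⟨fun l i => by simp, fun l => by simp⟩

theorem TranslatesEntry.mul {n : ℕ} {g h : Equiv.Perm (ℕ → ℤ)} {f k : (Fin n → Bool) → ℤ}
    (hg : TranslatesEntry n g f) (hh : TranslatesEntry n h k) :
    TranslatesEntry n (g * h) (f + k) := by
  refine ⟨fun l i => by rw [Equiv.Perm.mul_apply, hg.1, hh.1], fun l => ?_⟩
  have : parities n (h l) = parities n l := parities_eq_iff.2 fun j _ => hh.1 l j
  rw [Equiv.Perm.mul_apply, hg.2, hh.2, this, Pi.add_apply]
  ring

theorem TranslatesEntry.pow {n : ℕ} {g : Equiv.Perm (ℕ → ℤ)} {f : (Fin n → Bool) → ℤ}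
    (hg : TranslatesEntry n g f) (e : ℕ) : TranslatesEntry n (g ^ e) (e • f) := by
  induction e with
  | zero => simpa using TranslatesEntry.one n
  | succ e ih =>
    rw [pow_succ, succ_nsmul]
    exact ih.mul hg

theorem TranslatesEntry.list_prod {n : ℕ} {ι : Type*} (g : ι → Equiv.Perm (ℕ → ℤ))
    (f : ι → (Fin n → Bool) → ℤ) (h : ∀ i, TranslatesEntry n (g i) (f i)) (L : List ι) :
    TranslatesEntry n (L.map g).prod (L.map f).sum := by
  induction L with
  | nil => simpa using TranslatesEntry.one n
  | cons i L ih =>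
    rw [List.map_cons, List.map_cons, List.prod_cons, List.sum_cons]
    exact (h i).mul ih

/-- On parities the generators act as involutions. The sections permute the labels, which forces a
joint induction. -/
theorem even_sq_aux (n : ℕ) : ∀ l : ℕ → ℤ,
    (Even (gmPerm .b (gmPerm .b l) n) ↔ Even (l n)) ∧
    (Even (gmPerm .c (gmPerm .c l) n) ↔ Even (l n)) ∧
    (Even (gmPerm .d (gmPerm .d l) n) ↔ Even (l n)) ∧
    (Even (gmPerm .a (gmPerm .a l) n) ↔ Even (l n)) := by
  induction n with
  | zero =>
    intro l
    obtain ⟨k, w, rfl⟩ : ∃ k w, l = seqCons k w := ⟨_, _, (seqCons_seqTail l).symm⟩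
    simp only [gmPerm_a, gmPerm_b, gmPerm_c, gmPerm_d, seqCons_zero, true_and]
    simp [Int.even_add]
  | succ n ih =>
    intro l
    obtain ⟨k, w, rfl⟩ : ∃ k w, l = seqCons k w := ⟨_, _, (seqCons_seqTail l).symm⟩
    have := ih w
    by_cases h : Even k <;> simp [gmPerm_a, gmPerm_b, gmPerm_c, gmPerm_d, h, this]

/-- After `3 * j` odd entries the cycle `b → c → d → b` is back at `b`; a following even entry turns
it into `a`, whose square translates by `2`. An earlier even entry makes the section trivial before
depth `3 * j + 1`. -/
theorem b_sq_apply (j : ℕ) : ∀ l : ℕ → ℤ, gmPerm .b (gmPerm .b l) (3 * j + 1) =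
    l (3 * j + 1) + if (∀ i < 3 * j, ¬ Even (l i)) ∧ Even (l (3 * j)) then 2 else 0 := by
  induction j with
  | zero =>
    intro l
    obtain ⟨k, w, rfl⟩ : ∃ k w, l = seqCons k w := ⟨_, _, (seqCons_seqTail l).symm⟩
    obtain ⟨k', w, rfl⟩ : ∃ k w', w = seqCons k w' := ⟨_, _, (seqCons_seqTail w).symm⟩
    by_cases h : Even k
    · simp [gmPerm_a, gmPerm_b, h]
      ring
    · by_cases h' : Even k' <;> simp [gmPerm_b, gmPerm_c, h, h']
  | succ j ih =>
    intro l
    obtain ⟨k, w, rfl⟩ : ∃ k w, l = seqCons k w := ⟨_, _, (seqCons_seqTail l).symm⟩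
    obtain ⟨k₁, w, rfl⟩ : ∃ k w', w = seqCons k w' := ⟨_, _, (seqCons_seqTail w).symm⟩
    obtain ⟨k₂, w, rfl⟩ : ∃ k w', w = seqCons k w' := ⟨_, _, (seqCons_seqTail w).symm⟩
    have e : 3 * (j + 1) = 3 * j + 3 := by ring
    rw [e]
    have hall : (∀ i < 3 * j + 3, ¬ Even (seqCons k (seqCons k₁ (seqCons k₂ w)) i)) ↔
        ((¬ Even k ∧ ¬ Even k₁ ∧ ¬ Even k₂) ∧ ∀ i < 3 * j, ¬ Even (w i)) := by
      constructor
      · intro h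
        refine ⟨⟨h 0 (by omega), h 1 (by omega), h 2 (by omega)⟩, fun i hi => ?_⟩
        exact h (i + 3) (by omega)
      · rintro ⟨⟨h0, h1, h2⟩, h3⟩ i hi
        match i with
        | 0 => exact h0
        | 1 => exact h1
        | 2 => exact h2
        | i + 3 => exact h3 i (by omega)
    have := ih w
    simp only [hall]
    by_cases h : Even k
    · simp [gmPerm_a, gmPerm_b, h]
    · by_cases h1 : Even k₁
      · simp [gmPerm_a, gmPerm_b, gmPerm_c, h, h1]
      · by_cases h2 : Even k₂
        · simp [gmPerm_b, gmPerm_c, gmPerm_d, h, h1, h2]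
        · simp [gmPerm_b, gmPerm_c, gmPerm_d, h, h1, h2, this]

-- Conjugating `b²` by an `h` that carries the parity class of `b_sq_apply` to `t'` moves the
-- support there. The translation by `2` survives because the displacement under `h` depends only on
-- parities, which `b²` preserves.
open Classical in
theorem exists_translatesEntry (j : ℕ) (t' : Fin (3 * j + 1) → Bool) :
    ∃ g ∈ grigorchukMaki, TranslatesEntry (3 * j + 1) g (Pi.single t' 1) := by
  -- The parity class on which `b²` moves entry `3 * j + 1`: `3 * j` odd entries followed by an even
  -- one.
  let t : ℕ → ℤ := fun i => if i < 3 * j then 1 else 0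
  obtain ⟨u, hu⟩ := exists_parities_eq t'
  obtain ⟨h, hh, H⟩ := exists_even_iff (3 * j + 1) t u
  have htri := isTriangular_of_mem hh
  have htri' := isTriangular_of_mem (inv_mem hh)
  have hcls : ∀ l, parities (3 * j + 1) l = t' ↔
      parities (3 * j + 1) (h⁻¹ l) = parities (3 * j + 1) t := by
    intro l
    rw [← hu, parities_eq_iff, parities_eq_iff]
    constructor
    · intro hl
      have h1 := H t fun _ _ => Iff.rfl
      have h2 := htri'.even_iff (l := l) (l' := h t) fun i hi => (hl i hi).trans (h1 i hi).symm
      simpa using h2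
    · intro hl
      simpa using H _ hl
  have hbase : ∀ l, ((∀ i < 3 * j, ¬ Even (l i)) ∧ Even (l (3 * j))) ↔
      parities (3 * j + 1) l = parities (3 * j + 1) t := by
    intro l
    rw [parities_eq_iff]
    constructor
    · rintro ⟨h1, h2⟩ i hi
      rcases Nat.lt_succ_iff_lt_or_eq.1 hi with hi' | rfl
      · simp [t, hi', h1 i hi']
      · simp [t, h2]
    · intro h1
      refine ⟨fun i hi => ?_, ?_⟩
      · have := h1 i (by omega)
        simpa [t, hi] using this
      · have := h1 (3 * j) (by omega)
        simpa [t] using this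
  refine ⟨h * (gmPerm .b * gmPerm .b) * h⁻¹, mul_mem (mul_mem hh (mul_mem (gmPerm_mem _)
    (gmPerm_mem _))) (inv_mem hh), fun l i => ?_, fun l => ?_⟩
  · have h1 := htri.even_iff (n := i + 1) (l := gmPerm .b (gmPerm .b (h⁻¹ l))) (l' := h⁻¹ l)
      fun i _ => (even_sq_aux i _).1
    simpa using h1 i (by omega)
  · have h1 := htri (3 * j + 1) (gmPerm .b (gmPerm .b (h⁻¹ l))) (h⁻¹ l)
      fun i _ => (even_sq_aux i _).1
    have e : h (h⁻¹ l) = l := h.apply_symm_apply l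
    rw [b_sq_apply, e] at h1
    simp only [Equiv.Perm.mul_apply]
    simp only [hbase, ← hcls] at h1
    rw [Pi.single_apply]
    split_ifs at h1 ⊢ <;> linarith

theorem growthFunction_finite {G : Type*} [Group G] (S : Finset G) (n : ℕ) :
    {g : G | ∃ w : List G, w.length ≤ n ∧ (∀ s ∈ w, s ∈ S) ∧ w.prod = g}.Finite := by
  refine ((List.finite_length_le S n).image fun w => (w.map Subtype.val).prod).subset ?_
  rintro g ⟨w, hw, hS, rfl⟩
  refine ⟨w.attach.map fun s => ⟨s.1, hS s.1 s.2⟩, by simpa using hw, ?_⟩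
  simp [List.map_map, Function.comp_def]

theorem growthFunction_mono {G : Type*} [Group G] (S : Finset G) : Monotone (growthFunction S) := by
  intro m n hmn
  refine Set.ncard_le_ncard ?_ (growthFunction_finite S n)
  rintro g ⟨w, hw, hS, rfl⟩
  exact ⟨w, hw.trans hmn, hS, rfl⟩

-- Displacements of entry `3 * j + 1` add up under multiplication, so the exponents `e t ≤ m` can be
-- read off from `∏ x t ^ e t`. This gives `(m + 1) ^ (2 ^ (3 * j + 1))` distinct elements of length
-- `O(m)`.
open Classical in
theorem exists_pow_le_growthFunction {G : Type*} [Group G] (f : G →* Equiv.Perm (ℕ → ℤ))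
    (hf : ∀ h ∈ grigorchukMaki, ∃ g, f g = h) (S : Finset G) (hsymm : ∀ s ∈ S, s⁻¹ ∈ S)
    (hgen : Subgroup.closure (S : Set G) = ⊤) (j : ℕ) :
    ∃ K : ℕ, 0 < K ∧ ∀ m : ℕ, (m + 1) ^ (2 ^ (3 * j + 1)) ≤ growthFunction S (K * m) := by
  choose y hymem hy using exists_translatesEntry j
  choose x hx using fun t => hf (y t) (hymem t)
  have hword : ∀ g : G, ∃ w : List G, (∀ s ∈ w, s ∈ S) ∧ w.prod = g := by
    intro g
    have hg : g ∈ Subgroup.closure (S : Set G) := hgen ▸ Subgroup.mem_top g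
    rw [← Subgroup.mem_toSubmonoid, Subgroup.closure_toSubmonoid] at hg
    obtain ⟨w, hw, h⟩ := Submonoid.exists_list_of_mem_closure hg
    refine ⟨w, fun s hs => ?_, h⟩
    rcases hw s hs with h | h
    · exact h
    · simpa using hsymm _ h
  choose w hwS hwprod using fun t => hword (x t)
  let L : ℕ := Finset.univ.sup fun t => (w t).length
  let T := Fin (3 * j + 1) → Bool
  refine ⟨Fintype.card T * (L + 1), by positivity, fun m => ?_⟩
  let E : (T → Fin (m + 1)) → G :=
    fun e => ((Finset.univ : Finset T).toList.map fun t => x t ^ (e t : ℕ)).prod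
  have hE : ∀ e, TranslatesEntry (3 * j + 1) (f (E e)) fun t => (e t : ℤ) := by
    intro e
    have h1 := TranslatesEntry.list_prod (fun t => y t ^ (e t : ℕ)) _ (fun t => (hy t).pow (e t : ℕ))
      (Finset.univ : Finset T).toList
    have h2 : f (E e) = ((Finset.univ : Finset T).toList.map fun t => y t ^ (e t : ℕ)).prod := by
      simp only [E, map_list_prod, List.map_map]
      congr 2
      funext t
      simp [hx]
    rw [h2]
    convert h1 using 1
    rw [Finset.sum_map_toList]
    funext t
    simp [Finset.sum_apply, Pi.single_apply]
  have hinj : Function.Injective E := by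
    intro e e' h
    funext t
    obtain ⟨l, hl⟩ := exists_parities_eq t
    have h1 := (hE e).2 l
    rw [h, (hE e').2 l, hl] at h1
    have : (e t : ℤ) = (e' t : ℤ) := by linarith
    exact Fin.ext (by exact_mod_cast this)
  have hcard : (Set.range E).ncard = (m + 1) ^ (2 ^ (3 * j + 1)) := by
    rw [← Set.image_univ, Set.ncard_image_of_injective _ hinj, Set.ncard_univ]
    simp [T]
  rw [← hcard]
  refine Set.ncard_le_ncard ?_ (growthFunction_finite S _)
  rintro _ ⟨e, rfl⟩
  have hpow : ∀ t, ∃ v : List G, v.length ≤ (L + 1) * m ∧ (∀ s ∈ v, s ∈ S) ∧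
      v.prod = x t ^ (e t : ℕ) := by
    intro t
    refine ⟨(List.replicate (e t : ℕ) (w t)).flatten, ?_, ?_, ?_⟩
    · have h1 : (w t).length ≤ L :=
        Finset.le_sup (f := fun t => (w t).length) (Finset.mem_univ t)
      have h2 : (e t : ℕ) ≤ m := by omega
      simp only [List.length_flatten, List.map_replicate, List.sum_replicate, smul_eq_mul]
      rw [mul_comm]
      exact Nat.mul_le_mul (h1.trans (Nat.le_succ L)) h2
    · intro s hs
      obtain ⟨v, hv, hs⟩ := List.mem_flatten.1 hs
      rw [List.eq_of_mem_replicate hv] at hs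
      exact hwS t s hs
    · rw [List.prod_flatten, List.map_replicate, List.prod_replicate, hwprod]
  choose v hv1 hv2 hv3 using hpow
  refine ⟨((Finset.univ : Finset T).toList.map v).flatten, ?_, ?_, ?_⟩
  · rw [List.length_flatten, List.map_map]
    refine (List.sum_le_card_nsmul _ ((L + 1) * m) ?_).trans ?_
    · intro i hi
      obtain ⟨t, -, rfl⟩ := List.mem_map.1 hi
      exact hv1 t
    · rw [List.length_map, Finset.length_toList, Finset.card_univ, smul_eq_mul, mul_assoc]
  · intro s hs
    obtain ⟨u, hu, hs⟩ := List.mem_flatten.1 hs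
    obtain ⟨t, -, rfl⟩ := List.mem_map.1 hu
    exact hv2 t s hs
  · rw [List.prod_flatten, List.map_map]
    simp only [E]
    congr 2
    funext t
    exact hv3 t

/-- A group that maps onto the Grigorchuk–Maki group has superpolynomial growth. -/
theorem tendsto_growthFunction_div_natCast_pow {G : Type*} [Group G] (f : G →* Equiv.Perm (ℕ → ℤ))
    (hf : ∀ h ∈ grigorchukMaki, ∃ g, f g = h) (S : Finset G) (hsymm : ∀ s ∈ S, s⁻¹ ∈ S)
    (hgen : Subgroup.closure (S : Set G) = ⊤) (d : ℕ) :
    Tendsto (fun n : ℕ => (growthFunction S n : ℝ) / (n : ℝ) ^ d) atTop atTop := by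
  -- Depth `j = d` is enough: the exponent `2 ^ (3 * d + 1)` exceeds `d`, leaving at least one spare
  -- power of `n`.
  obtain ⟨K, hK, H⟩ := exists_pow_le_growthFunction f hf S hsymm hgen d
  set N : ℕ := 2 ^ (3 * d + 1) with hN
  have hdN : d + 1 ≤ N := by
    have : 3 * d + 1 < 2 ^ (3 * d + 1) := Nat.lt_two_pow_self
    omega
  have hlim : Tendsto (fun n : ℕ => (n : ℝ) / (K : ℝ) ^ N) atTop atTop :=
    tendsto_natCast_atTop_atTop.atTop_div_const (by positivity)
  refine tendsto_atTop_mono' atTop ?_ hlim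
  filter_upwards [eventually_ge_atTop 1] with n hn
  have hn' : (1 : ℝ) ≤ n := by exact_mod_cast hn
  rw [le_div_iff₀ (by positivity), div_mul_eq_mul_div, div_le_iff₀ (by positivity), ← pow_succ']
  have h1 : (n / K + 1) ^ N ≤ growthFunction S n :=
    (H (n / K)).trans (growthFunction_mono S (Nat.mul_div_le n K))
  have h2 : n ≤ K * (n / K + 1) := by
    have h3 := Nat.div_add_mod n K
    have h4 := Nat.mod_lt n hK
    rw [mul_add, mul_one]
    omega
  calc (n : ℝ) ^ (d + 1) ≤ (n : ℝ) ^ N := pow_le_pow_right₀ hn' hdN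
    _ ≤ ((K : ℝ) * ((n / K + 1 : ℕ) : ℝ)) ^ N := by
        gcongr
        exact_mod_cast h2
    _ = (((n / K + 1) ^ N : ℕ) : ℝ) * (K : ℝ) ^ N := by
        rw [Nat.cast_pow, mul_pow, mul_comm]
    _ ≤ _ := by
        gcongr

theorem fg_grigorchukMaki : Group.FG grigorchukMaki := by
  rw [Group.fg_iff_subgroup_fg, Subgroup.fg_iff]
  exact ⟨gmGenerators, rfl, by simp [gmGenerators]⟩

theorem hasIntermediateGrowth_of_mulEquiv {G : Type*} [Group G] (e : grigorchukMaki ≃* G) :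
    HasIntermediateGrowth G := by
  have hfg := fg_grigorchukMaki
  refine ⟨Group.fg_of_surjective (f := e.toMonoidHom) e.surjective, fun S hsymm hgen => ⟨?_, ?_⟩⟩
  · refine tendsto_growthFunction_div_natCast_pow (grigorchukMaki.subtype.comp e.symm.toMonoidHom)
      (fun h hh => ⟨e ⟨h, hh⟩, by simp⟩) S hsymm hgen
  · intro c hc
    exact tendsto_growthFunction_div_pow (grigorchukMaki.subtype.comp e.symm.toMonoidHom)
      (Subtype.val_injective.comp e.symm.injective) (fun g => (e.symm g).2) S hc

/-! ### An equivariant family of diffeomorphisms between intervals -/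

/-- The diffeomorphism from `(0, a)` to `(0, b)` of Yoccoz' equivariant family. -/
noncomputable def yoccoz (a b t : ℝ) : ℝ :=
  b / Real.pi * (Real.pi / 2 + Real.arctan (b / a * Real.tan (Real.pi * t / a - Real.pi / 2)))

/-- The derivative of `yoccoz a b`. -/
noncomputable def yoccozDeriv (a b t : ℝ) : ℝ :=
  1 / (1 + ((a / b) ^ 2 - 1) * Real.sin (Real.pi * t / a) ^ 2)

section yoccoz

variable {a b c t : ℝ}

theorem yoccoz_angle_mem (ha : 0 < a) (ht : t ∈ Ioo 0 a) :
    Real.pi * t / a - Real.pi / 2 ∈ Ioo (-(Real.pi / 2)) (Real.pi / 2) := by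
  have hpi := Real.pi_pos
  have h1 : 0 < Real.pi * t / a := div_pos (mul_pos hpi ht.1) ha
  have h2 : Real.pi * t / a < Real.pi := by
    rw [div_lt_iff₀ ha]
    exact mul_lt_mul_of_pos_left ht.2 hpi
  constructor <;> linarith

theorem yoccoz_mem (hb : 0 < b) (t : ℝ) : yoccoz a b t ∈ Ioo 0 b := by
  have hpi := Real.pi_pos
  have h1 := Real.neg_pi_div_two_lt_arctan (b / a * Real.tan (Real.pi * t / a - Real.pi / 2))
  have h2 := Real.arctan_lt_pi_div_two (b / a * Real.tan (Real.pi * t / a - Real.pi / 2))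
  constructor
  · exact mul_pos (div_pos hb hpi) (by linarith)
  · rw [yoccoz, div_mul_eq_mul_div, div_lt_iff₀ hpi]
    exact mul_lt_mul_of_pos_left (by linarith) hb

/-- In the tangent coordinates identifying each interval with `ℝ`, these maps are multiplications by
`b / a`, and the ratios multiply. -/
theorem yoccoz_yoccoz (hb : 0 < b) : yoccoz b c (yoccoz a b t) = yoccoz a c t := by
  have hpi := Real.pi_pos
  have h : Real.pi * yoccoz a b t / b - Real.pi / 2 =
      Real.arctan (b / a * Real.tan (Real.pi * t / a - Real.pi / 2)) := by
    rw [yoccoz]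
    field_simp
    ring
  rw [yoccoz, h, Real.tan_arctan, yoccoz, ← mul_assoc, div_mul_div_cancel₀ hb.ne']

theorem min_le_yoccozDeriv_denom (t : ℝ) :
    min 1 ((a / b) ^ 2) ≤ 1 + ((a / b) ^ 2 - 1) * Real.sin (Real.pi * t / a) ^ 2 := by
  have h0 := sq_nonneg (Real.sin (Real.pi * t / a))
  have h1 := Real.sin_sq_le_one (Real.pi * t / a)
  rcases le_total 1 ((a / b) ^ 2) with h | h
  · rw [min_eq_left h]
    nlinarith
  · rw [min_eq_right h]
    nlinarith

theorem yoccozDeriv_pos (ha : 0 < a) (hb : 0 < b) (t : ℝ) : 0 < yoccozDeriv a b t :=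
  one_div_pos.2 ((lt_min one_pos (by positivity)).trans_le (min_le_yoccozDeriv_denom t))

@[simp] theorem yoccozDeriv_zero : yoccozDeriv a b 0 = 1 := by
  simp [yoccozDeriv]

theorem yoccozDeriv_right (ha : 0 < a) : yoccozDeriv a b a = 1 := by
  simp [yoccozDeriv, ha.ne']

theorem yoccozDeriv_self (ha : 0 < a) : yoccozDeriv a a t = 1 := by
  simp [yoccozDeriv, ha.ne']

theorem continuous_yoccozDeriv (ha : 0 < a) (hb : 0 < b) : Continuous (yoccozDeriv a b) := by
  refine Continuous.div continuous_const (by fun_prop) fun t => ?_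
  exact ((lt_min one_pos (by positivity)).trans_le (min_le_yoccozDeriv_denom t)).ne'

theorem hasDerivAt_yoccoz (ha : 0 < a) (hb : 0 < b) (ht : t ∈ Ioo 0 a) :
    HasDerivAt (yoccoz a b) (yoccozDeriv a b t) t := by
  have hpi := Real.pi_pos
  have hθ := yoccoz_angle_mem ha ht
  set θ := Real.pi * t / a - Real.pi / 2 with hθdef
  have hcos : 0 < Real.cos θ := Real.cos_pos_of_mem_Ioo hθ
  have h1 : HasDerivAt (fun t : ℝ => Real.pi * t / a - Real.pi / 2) (Real.pi / a) t := by
    simpa using (((hasDerivAt_id t).const_mul Real.pi).div_const a).sub_const (Real.pi / 2)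
  have h2 := (Real.hasDerivAt_tan hcos.ne').comp t h1
  have h3 := (((h2.const_mul (b / a)).arctan).const_add (Real.pi / 2)).const_mul (b / Real.pi)
  refine h3.congr_deriv ?_
  have hsin : Real.sin (Real.pi * t / a) = Real.cos θ := by
    rw [hθdef, Real.cos_sub_pi_div_two]
  have hden : 0 < Real.cos θ ^ 2 * a ^ 2 + b ^ 2 * Real.sin θ ^ 2 := by positivity
  simp only [Function.comp_apply, ← hθdef, yoccozDeriv, hsin, Real.tan_eq_sin_div_cos]
  have e : 1 + ((a / b) ^ 2 - 1) * Real.cos θ ^ 2 =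
      (Real.cos θ ^ 2 * a ^ 2 + b ^ 2 * Real.sin θ ^ 2) / b ^ 2 := by
    rw [Real.sin_sq]
    field_simp
    ring
  have e2 : 1 + (b / a * (Real.sin θ / Real.cos θ)) ^ 2 =
      (Real.cos θ ^ 2 * a ^ 2 + b ^ 2 * Real.sin θ ^ 2) / (a ^ 2 * Real.cos θ ^ 2) := by
    field_simp
  rw [e, e2]
  field_simp

theorem tendsto_yoccoz_zero (ha : 0 < a) (hb : 0 < b) :
    Tendsto (yoccoz a b) (𝓝[>] 0) (𝓝 0) := by
  have hpi := Real.pi_pos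
  have h1 : Tendsto (fun t : ℝ => Real.pi * t / a - Real.pi / 2) (𝓝[>] 0)
      (𝓝[>] (-(Real.pi / 2))) := by
    refine tendsto_nhdsWithin_iff.2 ⟨?_, ?_⟩
    · have : Continuous fun t : ℝ => Real.pi * t / a - Real.pi / 2 := by fun_prop
      refine (this.tendsto' 0 _ (by simp)).mono_left nhdsWithin_le_nhds
    · filter_upwards [self_mem_nhdsWithin] with t ht
      have : 0 < Real.pi * t / a := div_pos (mul_pos hpi ht) ha
      simp only [mem_Ioi]
      linarith
  have h2 := (Real.tendsto_tan_neg_pi_div_two.comp h1).const_mul_atBot (div_pos hb ha)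
  have h3 := ((Real.tendsto_arctan_atBot.mono_right nhdsWithin_le_nhds).comp h2)
  have h4 := (h3.const_add (Real.pi / 2)).const_mul (b / Real.pi)
  have e : b / Real.pi * (Real.pi / 2 + -(Real.pi / 2)) = 0 := by simp
  rw [e] at h4
  exact h4

theorem tendsto_yoccoz_right (ha : 0 < a) (hb : 0 < b) :
    Tendsto (yoccoz a b) (𝓝[<] a) (𝓝 b) := by
  have hpi := Real.pi_pos
  have h1 : Tendsto (fun t : ℝ => Real.pi * t / a - Real.pi / 2) (𝓝[<] a)
      (𝓝[<] (Real.pi / 2)) := by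
    refine tendsto_nhdsWithin_iff.2 ⟨?_, ?_⟩
    · have : Continuous fun t : ℝ => Real.pi * t / a - Real.pi / 2 := by fun_prop
      refine (this.tendsto' a _ ?_).mono_left nhdsWithin_le_nhds
      field_simp
      ring
    · filter_upwards [self_mem_nhdsWithin] with t ht
      have : Real.pi * t / a < Real.pi := by
        rw [div_lt_iff₀ ha]
        exact mul_lt_mul_of_pos_left ht hpi
      simp only [mem_Iio]
      linarith
  have h2 := (Real.tendsto_tan_pi_div_two.comp h1).const_mul_atTop (div_pos hb ha)
  have h3 := ((Real.tendsto_arctan_atTop.mono_right nhdsWithin_le_nhds).comp h2)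
  have h4 := (h3.const_add (Real.pi / 2)).const_mul (b / Real.pi)
  have e : b / Real.pi * (Real.pi / 2 + Real.pi / 2) = b := by
    field_simp
    ring
  rw [e] at h4
  exact h4

theorem integral_yoccozDeriv (ha : 0 < a) (hb : 0 < b) (ht : t ∈ Ioo 0 a) :
    ∫ s in (0)..t, yoccozDeriv a b s = yoccoz a b t := by
  have h := intervalIntegral.integral_eq_sub_of_hasDerivAt_of_tendsto (f := yoccoz a b) ht.1
    (fun s hs => hasDerivAt_yoccoz ha hb ⟨hs.1, hs.2.trans ht.2⟩)
    ((continuous_yoccozDeriv ha hb).intervalIntegrable 0 t) (tendsto_yoccoz_zero ha hb)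
    ((hasDerivAt_yoccoz ha hb ht).continuousAt.tendsto.mono_left nhdsWithin_le_nhds)
  rw [h, sub_zero]

theorem integral_yoccozDeriv_right (ha : 0 < a) (hb : 0 < b) :
    ∫ s in (0)..a, yoccozDeriv a b s = b := by
  have h := intervalIntegral.integral_eq_sub_of_hasDerivAt_of_tendsto (f := yoccoz a b) ha
    (fun s hs => hasDerivAt_yoccoz ha hb hs)
    ((continuous_yoccozDeriv ha hb).intervalIntegrable 0 a) (tendsto_yoccoz_zero ha hb)
    (tendsto_yoccoz_right ha hb)
  rw [h, sub_zero]

end yoccoz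

/-! ### Diffeomorphisms of the interval induced by order automorphisms -/

/-- Positive lengths, of total sum `1`, indexed by an ordered set. -/
structure LengthSystem (Ω : Type*) where
  /-- The length attached to an index. -/
  len : Ω → ℝ
  len_pos : ∀ ω, 0 < len ω
  hasSum : HasSum len 1

namespace LengthSystem

open MeasureTheory

variable {Ω : Type*} [LinearOrder Ω] (l : LengthSystem Ω)

/-- The left end point of the interval attached to an index. -/
noncomputable def left (ω : Ω) : ℝ := ∑' ω', (Iio ω).indicator l.len ω'

/-- The interval attached to an index. -/
noncomputable def piece (ω : Ω) : Set ℝ := Ioo (l.left ω) (l.left ω + l.len ω)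

theorem left_nonneg (ω : Ω) : 0 ≤ l.left ω :=
  tsum_nonneg fun _ => indicator_nonneg (fun _ _ => (l.len_pos _).le) _

theorem left_add_len (ω : Ω) : l.left ω + l.len ω = ∑' ω', (Iic ω).indicator l.len ω' := by
  have h1 : HasSum (({ω} : Set Ω).indicator l.len) (l.len ω) := by
    have := hasSum_single (f := ({ω} : Set Ω).indicator l.len) ω fun b hb =>
      indicator_of_notMem (by simpa using hb) _
    rwa [indicator_of_mem (mem_singleton ω)] at this
  have h2 := (l.hasSum.summable.indicator (Iio ω)).hasSum.add h1
  rw [left, ← h2.tsum_eq]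
  congr 1
  rw [← indicator_union_of_disjoint (by simp), Iio_union_right]

theorem left_add_len_le {ω ω' : Ω} (h : ω < ω') : l.left ω + l.len ω ≤ l.left ω' := by
  rw [left_add_len]
  refine (l.hasSum.summable.indicator _).tsum_le_tsum (fun i => ?_) (l.hasSum.summable.indicator _)
  exact indicator_le_indicator_of_subset (fun i hi => lt_of_le_of_lt hi h)
    (fun i => (l.len_pos i).le) i

theorem left_add_len_le_one (ω : Ω) : l.left ω + l.len ω ≤ 1 := by
  rw [left_add_len, ← l.hasSum.tsum_eq]
  refine (l.hasSum.summable.indicator _).tsum_le_tsum (fun i => ?_) l.hasSum.summable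
  exact indicator_le_self' (fun _ _ => (l.len_pos _).le) i

theorem left_strictMono : StrictMono l.left := fun ω ω' h => by
  have := l.left_add_len_le h
  have := l.len_pos ω
  linarith

theorem piece_subset (ω : Ω) : l.piece ω ⊆ Ioo 0 1 :=
  Ioo_subset_Ioo (l.left_nonneg ω) (l.left_add_len_le_one ω)

theorem eq_of_mem_piece {ω ω' : Ω} {x : ℝ} (h : x ∈ l.piece ω) (h' : x ∈ l.piece ω') :
    ω = ω' := by
  rcases lt_trichotomy ω ω' with hlt | rfl | hlt
  · have := l.left_add_len_le hlt
    have := h.2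
    have := h'.1
    linarith
  · rfl
  · have := l.left_add_len_le hlt
    have := h.1
    have := h'.2
    linarith

theorem pairwise_disjoint_piece : Pairwise (Function.onFun Disjoint l.piece) := fun _ _ hne =>
  Set.disjoint_left.2 fun _ h h' => hne (l.eq_of_mem_piece h h')

theorem volume_compl_pieces [Countable Ω] : volume (Icc (0 : ℝ) 1 \ ⋃ ω, l.piece ω) = 0 := by
  have h1 : volume (⋃ ω, l.piece ω) = 1 := by
    rw [measure_iUnion l.pairwise_disjoint_piece fun ω => measurableSet_Ioo]
    simp only [piece, Real.volume_Ioo, add_sub_cancel_left]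
    rw [← ENNReal.ofReal_tsum_of_nonneg (fun ω => (l.len_pos ω).le) l.hasSum.summable,
      l.hasSum.tsum_eq, ENNReal.ofReal_one]
  rw [measure_sdiff, h1, Real.volume_Icc]
  · simp
  · exact iUnion_subset fun ω => (l.piece_subset ω).trans Ioo_subset_Icc_self
  · exact (MeasurableSet.iUnion fun ω => measurableSet_Ioo).nullMeasurableSet
  · rw [h1]
    exact ENNReal.one_ne_top

open Classical in
/-- The derivative of the diffeomorphism induced by an automorphism of the index set. -/
noncomputable def density (e : Ω ≃o Ω) (x : ℝ) : ℝ :=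
  if h : ∃ ω, x ∈ l.piece ω then
    yoccozDeriv (l.len h.choose) (l.len (e h.choose)) (x - l.left h.choose) else 1

theorem density_of_mem {e : Ω ≃o Ω} {ω : Ω} {x : ℝ} (h : x ∈ l.piece ω) :
    l.density e x = yoccozDeriv (l.len ω) (l.len (e ω)) (x - l.left ω) := by
  have h' : ∃ ω, x ∈ l.piece ω := ⟨ω, h⟩
  rw [density, dif_pos h', l.eq_of_mem_piece h'.choose_spec h]

theorem density_of_forall_notMem {e : Ω ≃o Ω} {x : ℝ} (h : ∀ ω, x ∉ l.piece ω) :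
    l.density e x = 1 := by
  rw [density, dif_neg (by simpa using h)]

theorem left_notMem_piece (ω ω' : Ω) : l.left ω ∉ l.piece ω' := by
  intro h
  rcases lt_or_ge ω' ω with hlt | hle
  · exact absurd h.2 (not_lt.2 (l.left_add_len_le hlt))
  · exact absurd h.1 (not_lt.2 (l.left_strictMono.monotone hle))

theorem right_notMem_piece (ω ω' : Ω) : l.left ω + l.len ω ∉ l.piece ω' := by
  intro h
  rcases lt_or_ge ω ω' with hlt | hle
  · exact absurd h.1 (not_lt.2 (l.left_add_len_le hlt))
  · rcases hle.lt_or_eq with hlt | rfl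
    · have := l.left_add_len_le hlt
      have := h.2
      have := l.len_pos ω
      linarith
    · exact lt_irrefl _ h.2

/-- The formula extends to end points, which lie in no piece, because the Yoccoz derivatives equal
`1` there. This is what makes the pieces glue in a `C¹` way. -/
theorem density_of_mem_Icc {e : Ω ≃o Ω} {ω : Ω} {x : ℝ}
    (h : x ∈ Icc (l.left ω) (l.left ω + l.len ω)) :
    l.density e x = yoccozDeriv (l.len ω) (l.len (e ω)) (x - l.left ω) := by
  rcases eq_or_lt_of_le h.1 with rfl | h1
  · rw [l.density_of_forall_notMem (l.left_notMem_piece ω), sub_self, yoccozDeriv_zero]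
  · rcases eq_or_lt_of_le h.2 with rfl | h2
    · rw [l.density_of_forall_notMem (l.right_notMem_piece ω), add_sub_cancel_left,
        yoccozDeriv_right (l.len_pos ω)]
    · exact l.density_of_mem ⟨h1, h2⟩

theorem density_pos (e : Ω ≃o Ω) (x : ℝ) : 0 < l.density e x := by
  by_cases h : ∃ ω, x ∈ l.piece ω
  · obtain ⟨ω, h⟩ := h
    rw [l.density_of_mem h]
    exact yoccozDeriv_pos (l.len_pos _) (l.len_pos _) _
  · push Not at h
    rw [l.density_of_forall_notMem h]
    exact one_pos

theorem density_one (x : ℝ) : l.density (1 : Ω ≃o Ω) x = 1 := by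
  by_cases h : ∃ ω, x ∈ l.piece ω
  · obtain ⟨ω, h⟩ := h
    rw [l.density_of_mem h]
    exact yoccozDeriv_self (l.len_pos _)
  · push Not at h
    exact l.density_of_forall_notMem h

/-- The distortion of the automorphism `e` on each piece is at most `M` times the modulus `σ`. -/
def IsTame (σ : ℝ → ℝ) (M : ℝ) (e : Ω ≃o Ω) : Prop :=
  ∀ ω, ∀ x ∈ Icc 0 (l.len ω), ∀ y ∈ Icc 0 (l.len ω),
    |yoccozDeriv (l.len ω) (l.len (e ω)) x - yoccozDeriv (l.len ω) (l.len (e ω)) y| ≤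
      M * σ |x - y|

variable {l} {σ : ℝ → ℝ} {M : ℝ} {e : Ω ≃o Ω}

theorem IsTame.abs_density_sub_le_of_mem (h : l.IsTame σ M e) {ω : Ω} {x y : ℝ}
    (hx : x ∈ Icc (l.left ω) (l.left ω + l.len ω)) (hy : y ∈ Icc (l.left ω) (l.left ω + l.len ω)) :
    |l.density e x - l.density e y| ≤ M * σ |x - y| := by
  rw [l.density_of_mem_Icc hx, l.density_of_mem_Icc hy]
  have := h ω (x - l.left ω) ⟨by linarith [hx.1], by linarith [hx.2]⟩ (y - l.left ω)
    ⟨by linarith [hy.1], by linarith [hy.2]⟩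
  rwa [sub_sub_sub_cancel_right] at this

/-- If `x` lies in a piece, then an end point of that piece separates it from `y`. The density is
`1` at this end point, which is no farther from `x` than `y` is. -/
theorem IsTame.abs_density_sub_one_le_of_notMem (h : l.IsTame σ M e) (hσ : MonotoneOn σ (Icc 0 1))
    (hσ0 : σ 0 = 0) (hM : 0 ≤ M) {x y : ℝ} (hx : x ∈ Icc 0 1) (hy : y ∈ Icc 0 1)
    (hxy : ∀ ω, x ∈ l.piece ω → y ∉ l.piece ω) :
    |l.density e x - 1| ≤ M * σ |x - y| := by
  have hxy1 : |x - y| ∈ Icc (0 : ℝ) 1 :=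
    ⟨abs_nonneg _, abs_le.2 ⟨by linarith [hx.1, hy.2], by linarith [hx.2, hy.1]⟩⟩
  have hσnn : 0 ≤ σ |x - y| := by
    rw [← hσ0]
    exact hσ (left_mem_Icc.2 zero_le_one) hxy1 hxy1.1
  by_cases hex : ∃ ω, x ∈ l.piece ω
  · obtain ⟨ω, hω⟩ := hex
    have hy' := hxy ω hω
    have hlen := (l.len_pos ω).le
    have hx' : x ∈ Icc (l.left ω) (l.left ω + l.len ω) := Ioo_subset_Icc_self hω
    rcases le_or_gt y (l.left ω) with hle | hlt
    · have h1 := h.abs_density_sub_le_of_mem hx' (left_mem_Icc.2 (by linarith))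
      rw [l.density_of_forall_notMem (l.left_notMem_piece ω)] at h1
      refine h1.trans (mul_le_mul_of_nonneg_left (hσ ⟨abs_nonneg _, ?_⟩ hxy1 ?_) hM)
      · rw [abs_of_nonneg (by linarith [hx'.1])]
        linarith [hx.2, l.left_nonneg ω]
      · rw [abs_of_nonneg (by linarith [hx'.1]), abs_of_nonneg (by linarith [hx'.1])]
        linarith
    · have hle : l.left ω + l.len ω ≤ y := by
        by_contra! hcon
        exact hy' ⟨hlt, hcon⟩
      have h1 := h.abs_density_sub_le_of_mem hx' (right_mem_Icc.2 (by linarith))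
      rw [l.density_of_forall_notMem (l.right_notMem_piece ω)] at h1
      refine h1.trans (mul_le_mul_of_nonneg_left (hσ ⟨abs_nonneg _, ?_⟩ hxy1 ?_) hM)
      · rw [abs_of_nonpos (by linarith [hx'.2])]
        linarith [hx.1, l.left_add_len_le_one ω]
      · rw [abs_of_nonpos (by linarith [hx'.2]), abs_of_nonpos (by linarith [hx'.2])]
        linarith
  · push Not at hex
    rw [l.density_of_forall_notMem hex, sub_self, abs_zero]
    exact mul_nonneg hM hσnn

/-- The factor `2` comes from points without a common piece, whose densities are compared through
the value `1`. -/
theorem IsTame.abs_density_sub_le (h : l.IsTame σ M e) (hσ : MonotoneOn σ (Icc 0 1))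
    (hσ0 : σ 0 = 0) (hM : 0 ≤ M) {x y : ℝ} (hx : x ∈ Icc 0 1) (hy : y ∈ Icc 0 1) :
    |l.density e x - l.density e y| ≤ 2 * M * σ |x - y| := by
  have hxy1 : |x - y| ∈ Icc (0 : ℝ) 1 :=
    ⟨abs_nonneg _, abs_le.2 ⟨by linarith [hx.1, hy.2], by linarith [hx.2, hy.1]⟩⟩
  have hσnn : 0 ≤ σ |x - y| := by
    rw [← hσ0]
    exact hσ (left_mem_Icc.2 zero_le_one) hxy1 hxy1.1
  by_cases hex : ∃ ω, x ∈ l.piece ω ∧ y ∈ l.piece ω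
  · obtain ⟨ω, h1, h2⟩ := hex
    have := h.abs_density_sub_le_of_mem (Ioo_subset_Icc_self h1) (Ioo_subset_Icc_self h2)
    have := mul_nonneg hM hσnn
    linarith
  · push Not at hex
    have h1 := h.abs_density_sub_one_le_of_notMem hσ hσ0 hM hx hy hex
    have h2 := h.abs_density_sub_one_le_of_notMem hσ hσ0 hM hy hx fun ω h1 h2 => hex ω h2 h1
    rw [abs_sub_comm y x] at h2
    have h3 := abs_sub_le (l.density e x) 1 (l.density e y)
    rw [abs_sub_comm 1] at h3
    linarith

theorem density_zero : l.density e 0 = 1 :=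
  l.density_of_forall_notMem fun ω h => lt_irrefl _ (l.piece_subset ω h).1

theorem IsTame.continuous_density (h : l.IsTame σ M e) (hσ : MonotoneOn σ (Icc 0 1))
    (hσ0 : σ 0 = 0) (hσc : ContinuousWithinAt σ (Icc 0 1) 0) (hM : 0 ≤ M) :
    Continuous (l.density e) := by
  have h1 : Continuous fun x : Icc (0 : ℝ) 1 => l.density e x := by
    rw [continuous_iff_continuousAt]
    intro x
    rw [ContinuousAt, tendsto_iff_dist_tendsto_zero]
    have h2 : Tendsto (fun y : Icc (0 : ℝ) 1 => |(y : ℝ) - x|) (𝓝 x) (𝓝[Icc 0 1] 0) := by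
      refine tendsto_nhdsWithin_iff.2 ⟨?_, Eventually.of_forall fun y => ?_⟩
      · have : Continuous fun y : Icc (0 : ℝ) 1 => |(y : ℝ) - x| := by fun_prop
        exact this.tendsto' x 0 (by simp)
      · exact ⟨abs_nonneg _, abs_le.2 ⟨by linarith [y.2.1, x.2.2], by linarith [y.2.2, x.2.1]⟩⟩
    have h3 := (hσc.tendsto.comp h2).const_mul (2 * M)
    rw [hσ0, mul_zero] at h3
    refine squeeze_zero (fun _ => dist_nonneg) (fun y => ?_) h3
    rw [Real.dist_eq]
    exact h.abs_density_sub_le hσ hσ0 hM y.2 x.2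
  have h2 : l.density e = fun x => l.density e (projIcc 0 1 zero_le_one x) := by
    funext x
    by_cases hx : x ∈ Icc (0 : ℝ) 1
    · rw [projIcc_of_mem zero_le_one hx]
    · rw [l.density_of_forall_notMem fun ω hω => hx (Ioo_subset_Icc_self (l.piece_subset ω hω))]
      rcases le_or_gt x 0 with h0 | h0
      · rw [projIcc_of_le_left zero_le_one h0]
        exact density_zero.symm
      · have h1 : 1 ≤ x := by
          by_contra! hcon
          exact hx ⟨h0.le, hcon.le⟩
        rw [projIcc_of_right_le zero_le_one h1]
        exact (l.density_of_forall_notMem fun ω h => lt_irrefl _ (l.piece_subset ω h).2).symm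
  rw [h2]
  exact h1.comp continuous_projIcc

end LengthSystem

/-! ### Integration of the density and the resulting group action. -/

namespace LengthSystem

open MeasureTheory

variable {Ω : Type*} [LinearOrder Ω] (l : LengthSystem Ω)

/-- The diffeomorphism induced by an automorphism of the index set. -/
noncomputable def realize (e : Ω ≃o Ω) (x : ℝ) : ℝ := ∫ t in (0)..x, l.density e t

variable {l} {e : Ω ≃o Ω}

theorem realize_zero : l.realize e 0 = 0 := intervalIntegral.integral_same

theorem realize_one_apply (x : ℝ) : l.realize (1 : Ω ≃o Ω) x = x := by
  simp [realize, l.density_one]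

theorem hasDerivAt_realize (hc : Continuous (l.density e)) (x : ℝ) :
    HasDerivAt (l.realize e) (l.density e x) x :=
  intervalIntegral.integral_hasDerivAt_right (hc.intervalIntegrable _ _)
    hc.aestronglyMeasurable.stronglyMeasurableAtFilter hc.continuousAt

theorem strictMono_realize (hc : Continuous (l.density e)) : StrictMono (l.realize e) :=
  strictMono_of_hasDerivAt_pos (hasDerivAt_realize hc) (l.density_pos e)

theorem contDiff_realize (hc : Continuous (l.density e)) : ContDiff ℝ 1 (l.realize e) := by
  rw [contDiff_one_iff_deriv]
  refine ⟨fun x => (hasDerivAt_realize hc x).differentiableAt, ?_⟩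
  have : deriv (l.realize e) = l.density e := funext fun x => (hasDerivAt_realize hc x).deriv
  rwa [this]

theorem integral_density_left {ω : Ω} {x : ℝ} (hx : x ∈ Icc (l.left ω) (l.left ω + l.len ω)) :
    ∫ t in (l.left ω)..x, l.density e t =
      ∫ t in (0)..(x - l.left ω), yoccozDeriv (l.len ω) (l.len (e ω)) t := by
  rw [← sub_self (l.left ω), ← intervalIntegral.integral_comp_sub_right]
  refine intervalIntegral.integral_congr fun t ht => ?_
  rw [uIcc_of_le hx.1] at ht
  exact l.density_of_mem_Icc ⟨ht.1, ht.2.trans hx.2⟩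

theorem setIntegral_density_piece (ω : Ω) : ∫ t in l.piece ω, l.density e t = l.len (e ω) := by
  have hlen := l.len_pos ω
  rw [piece, ← integral_Ioc_eq_integral_Ioo, ← intervalIntegral.integral_of_le (by linarith),
    integral_density_left (right_mem_Icc.2 (by linarith)), add_sub_cancel_left,
    integral_yoccozDeriv_right hlen (l.len_pos _)]

/-- The pieces fill `[0,1]` up to a null set, so the integral of the density up to a cut is the sum
of the image lengths on its left. -/
theorem realize_eq_tsum [Countable Ω] (hc : Continuous (l.density e)) {x : ℝ} (hx : x ∈ Icc 0 1)
    {U : Set Ω} (hU : ∀ ω ∈ U, l.left ω + l.len ω ≤ x) (hU' : ∀ ω ∉ U, x ≤ l.left ω) :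
    l.realize e x = ∑' ω, U.indicator (fun ω => l.len (e ω)) ω := by
  have hsub : (⋃ ω : U, l.piece ω) ⊆ Ioc 0 x := by
    refine iUnion_subset fun ω t ht => ⟨(l.piece_subset _ ht).1, ht.2.le.trans (hU _ ω.2)⟩
  have hae : (Ioc 0 x : Set ℝ) =ᵐ[volume] ⋃ ω : U, l.piece ω := by
    rw [ae_eq_set]
    refine ⟨measure_mono_null ?_ l.volume_compl_pieces,
      by rw [sdiff_eq_empty.2 hsub, measure_empty]⟩
    rintro t ⟨ht, htU⟩
    refine ⟨⟨ht.1.le, ht.2.trans hx.2⟩, fun h => htU ?_⟩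
    obtain ⟨ω, hω⟩ := mem_iUnion.1 h
    refine mem_iUnion.2 ⟨⟨ω, ?_⟩, hω⟩
    by_contra hcon
    exact absurd (hω.1.trans_le ht.2) (not_lt.2 (hU' ω hcon))
  rw [realize, intervalIntegral.integral_of_le hx.1, setIntegral_congr_set hae, integral_iUnion]
  · simp only [setIntegral_density_piece]
    exact tsum_subtype U fun ω => l.len (e ω)
  · exact fun ω => measurableSet_Ioo
  · exact fun ω ω' hne => l.pairwise_disjoint_piece fun h => hne (Subtype.ext h)
  · exact (hc.integrableOn_Icc (a := 0) (b := x)).mono_set (hsub.trans Ioc_subset_Icc_self)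

theorem realize_left [Countable Ω] (hc : Continuous (l.density e)) (ω : Ω) :
    l.realize e (l.left ω) = l.left (e ω) := by
  have hlen := l.len_pos ω
  rw [realize_eq_tsum hc ⟨l.left_nonneg ω, by linarith [l.left_add_len_le_one ω]⟩ (U := Iio ω)
    (fun ω' h => l.left_add_len_le h)
    (fun ω' h => l.left_strictMono.monotone (not_lt.1 h)), left,
    ← e.toEquiv.tsum_eq ((Iio (e ω)).indicator l.len)]
  congr 1
  funext ω'
  show _ = (Iio (e ω)).indicator l.len (e ω')
  by_cases h : ω' < ω
  · rw [indicator_of_mem (mem_Iio.2 h), indicator_of_mem (mem_Iio.2 (e.lt_iff_lt.2 h))]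
  · rw [indicator_of_notMem (by simpa using h), indicator_of_notMem (by simpa using h)]

theorem realize_one [Countable Ω] (hc : Continuous (l.density e)) : l.realize e 1 = 1 := by
  rw [realize_eq_tsum hc (right_mem_Icc.2 zero_le_one) (U := univ)
    (fun ω' _ => l.left_add_len_le_one ω') (fun ω' h => absurd (mem_univ _) h), indicator_univ]
  exact (e.toEquiv.tsum_eq l.len).trans l.hasSum.tsum_eq

theorem realize_of_mem_piece [Countable Ω] (hc : Continuous (l.density e)) {ω : Ω} {x : ℝ}
    (hx : x ∈ l.piece ω) : l.realize e x =
      l.left (e ω) + yoccoz (l.len ω) (l.len (e ω)) (x - l.left ω) := by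
  rw [← realize_left hc, realize, realize, ← intervalIntegral.integral_add_adjacent_intervals
    (hc.intervalIntegrable 0 (l.left ω)) (hc.intervalIntegrable (l.left ω) x),
    integral_density_left (Ioo_subset_Icc_self hx),
    integral_yoccozDeriv (l.len_pos _) (l.len_pos _) ⟨by linarith [hx.1], by linarith [hx.2]⟩]

theorem realize_mem_piece [Countable Ω] (hc : Continuous (l.density e)) {ω : Ω} {x : ℝ}
    (hx : x ∈ l.piece ω) : l.realize e x ∈ l.piece (e ω) := by
  rw [realize_of_mem_piece hc hx]
  have := yoccoz_mem (a := l.len ω) (l.len_pos (e ω)) (x - l.left ω)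
  exact ⟨by linarith [this.1], by linarith [this.2]⟩

/-- On each piece this is the cocycle relation of the Yoccoz family. The pieces have full measure,
and continuity does the rest. -/
theorem realize_mul [Countable Ω] {e' : Ω ≃o Ω} (hc : Continuous (l.density e))
    (hc' : Continuous (l.density e')) (hc'' : Continuous (l.density (e * e'))) :
    EqOn (l.realize (e * e')) (l.realize e ∘ l.realize e') (Icc 0 1) := by
  have hcont {e : Ω ≃o Ω} (hc : Continuous (l.density e)) : Continuous (l.realize e) :=
    (contDiff_realize hc).continuous
  refine Measure.eqOn_Icc_of_ae_eq (volume : Measure ℝ) zero_ne_one ?_ (hcont hc'').continuousOn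
    ((hcont hc).comp (hcont hc')).continuousOn
  rw [EventuallyEq, ae_restrict_iff' measurableSet_Icc]
  have h0 : ∀ᵐ x : ℝ, x ∉ Icc (0 : ℝ) 1 \ ⋃ ω, l.piece ω :=
    measure_eq_zero_iff_ae_notMem.1 l.volume_compl_pieces
  filter_upwards [h0] with x hx hx1
  have h1 : x ∈ ⋃ ω, l.piece ω := by
    by_contra hcon
    exact hx ⟨hx1, hcon⟩
  obtain ⟨ω, hω⟩ := mem_iUnion.1 h1
  rw [Function.comp_apply, realize_of_mem_piece hc'' hω,
    realize_of_mem_piece hc (realize_mem_piece hc' hω), realize_of_mem_piece hc' hω,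
    add_sub_cancel_left, yoccoz_yoccoz (l.len_pos _)]
  rfl

theorem realize_mem_Icc [Countable Ω] (hc : Continuous (l.density e)) {x : ℝ} (hx : x ∈ Icc 0 1) :
    l.realize e x ∈ Icc (0 : ℝ) 1 := by
  have hm := (strictMono_realize hc).monotone
  exact ⟨realize_zero.symm.trans_le (hm hx.1), (hm hx.2).trans_eq (realize_one hc)⟩

theorem realize_inv_realize {G : Type*} [Group G] {ρ : G →* (Ω ≃o Ω)}
    (hc : ∀ g, Continuous (l.density (ρ g))) [Countable Ω] (g : G) {x : ℝ} (hx : x ∈ Icc 0 1) :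
    l.realize (ρ g⁻¹) (l.realize (ρ g) x) = x := by
  have h1 : ρ g⁻¹ * ρ g = 1 := by rw [← map_mul, inv_mul_cancel, map_one]
  have h2 : Continuous (l.density (ρ g⁻¹ * ρ g)) := by
    rw [← map_mul]
    exact hc _
  have h := realize_mul (hc g⁻¹) (hc g) h2 hx
  rw [h1, realize_one_apply] at h
  exact h.symm

variable (l) in
/-- The action by homeomorphisms of the interval induced by an action on the index set. -/
noncomputable def homeo [Countable Ω] {G : Type*} [Group G] (ρ : G →* (Ω ≃o Ω))
    (hc : ∀ g, Continuous (l.density (ρ g))) : G →* (unitInterval ≃ₜ unitInterval) where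
  toFun g :=
    { toFun := fun x => ⟨l.realize (ρ g) x, realize_mem_Icc (hc g) x.2⟩
      invFun := fun x => ⟨l.realize (ρ g⁻¹) x, realize_mem_Icc (hc g⁻¹) x.2⟩
      left_inv := fun x => Subtype.ext (realize_inv_realize hc g x.2)
      right_inv := fun x => Subtype.ext (by
        have := realize_inv_realize hc g⁻¹ x.2
        rwa [inv_inv] at this)
      continuous_toFun :=
        ((contDiff_realize (hc g)).continuous.comp continuous_subtype_val).subtype_mk _
      continuous_invFun :=
        ((contDiff_realize (hc g⁻¹)).continuous.comp continuous_subtype_val).subtype_mk _ }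
  map_one' := by
    ext x
    show l.realize (ρ 1) x = x
    rw [map_one, realize_one_apply]
  map_mul' g h := by
    ext x
    show l.realize (ρ (g * h)) x = l.realize (ρ g) (l.realize (ρ h) x)
    have h2 : Continuous (l.density (ρ g * ρ h)) := by
      rw [← map_mul]
      exact hc _
    rw [map_mul]
    exact realize_mul (hc g) (hc h) h2 x.2

section homeo

variable [Countable Ω] {G : Type*} [Group G] {ρ : G →* (Ω ≃o Ω)}
  (hc : ∀ g, Continuous (l.density (ρ g)))

theorem coe_homeo_apply (g : G) (x : unitInterval) :
    (l.homeo ρ hc g x : ℝ) = l.realize (ρ g) x := rfl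

theorem intervalFun_homeo (g : G) {x : ℝ} (hx : x ∈ Icc 0 1) :
    intervalFun (l.homeo ρ hc g) x = l.realize (ρ g) x := by
  rw [intervalFun, coe_homeo_apply, projIcc_of_mem zero_le_one hx]

theorem contDiffOn_intervalFun_homeo (g : G) :
    ContDiffOn ℝ 1 (intervalFun (l.homeo ρ hc g)) (Icc 0 1) :=
  (contDiff_realize (hc g)).contDiffOn.congr fun _ hx => intervalFun_homeo hc g hx

theorem homeo_mem_diffOne (g : G) : l.homeo ρ hc g ∈ diffOne := by
  refine ⟨fun x y hxy => ?_, contDiffOn_intervalFun_homeo hc g, ?_⟩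
  · exact (strictMono_realize (hc g)).monotone hxy
  · rw [← map_inv]
    exact contDiffOn_intervalFun_homeo hc g⁻¹

theorem intervalDeriv_homeo (g : G) {x : ℝ} (hx : x ∈ Icc 0 1) :
    intervalDeriv (l.homeo ρ hc g) x = l.density (ρ g) x := by
  have h := ((hasDerivAt_realize (hc g) x).hasDerivWithinAt (s := Icc 0 1)).congr
    (fun y hy => intervalFun_homeo hc g hy) (intervalFun_homeo hc g hx)
  exact h.derivWithin (uniqueDiffOn_Icc zero_lt_one x hx)

variable (l) in
/-- The action by diffeomorphisms of the interval induced by an action on the index set. -/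
noncomputable def diffeo (ρ : G →* (Ω ≃o Ω)) (hc : ∀ g, Continuous (l.density (ρ g))) :
    G →* diffOne :=
  (l.homeo ρ hc).codRestrict diffOne (homeo_mem_diffOne hc)

theorem coe_diffeo (g : G) : (l.diffeo ρ hc g).1 = l.homeo ρ hc g := rfl

/-- The action on left end points recovers the action on indices. -/
theorem diffeo_injective (hρ : Function.Injective ρ) : Function.Injective (l.diffeo ρ hc) := by
  rw [injective_iff_map_eq_one]
  intro g hg
  refine (injective_iff_map_eq_one ρ).1 hρ g ?_
  refine DFunLike.ext _ _ fun ω => ?_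
  refine l.left_strictMono.injective ?_
  rw [← realize_left (hc g)]
  have hx : l.left ω ∈ Icc (0 : ℝ) 1 :=
    ⟨l.left_nonneg ω, by linarith [l.left_add_len_le_one ω, l.len_pos ω]⟩
  have h1 : l.homeo ρ hc g = 1 := by
    rw [← coe_diffeo hc g, hg]
    rfl
  have h2 := coe_homeo_apply hc g ⟨l.left ω, hx⟩
  rw [h1] at h2
  exact h2.symm

theorem sigmaNormLE_diffeo {σ : ℝ → ℝ} (hσ : IsLogModulus σ) {M : ℝ} (hM : 0 ≤ M) {g : G}
    (h : l.IsTame σ M (ρ g)) : SigmaNormLE σ (intervalDeriv (l.diffeo ρ hc g).1) (2 * M) := by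
  intro x hx y hy hxy
  have h0 : 0 < |x - y| := abs_pos.2 (sub_ne_zero.2 hxy)
  have h1 : |x - y| ∈ Icc (0 : ℝ) 1 :=
    ⟨abs_nonneg _, abs_le.2 ⟨by linarith [hx.1, hy.2], by linarith [hx.2, hy.1]⟩⟩
  have hpos : 0 < σ |x - y| := by
    rw [← hσ.map_zero]
    exact hσ.strictMonoOn (left_mem_Icc.2 zero_le_one) h1 h0
  rw [coe_diffeo, intervalDeriv_homeo hc g hx, intervalDeriv_homeo hc g hy, abs_div,
    abs_of_pos hpos, div_le_iff₀ hpos]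
  exact h.abs_density_sub_le hσ.strictMonoOn.monotoneOn hσ.map_zero hM hx hy

theorem isSigmaCloseToId_diffeo {σ : ℝ → ℝ} (hσ : IsLogModulus σ) {M ε : ℝ} (hM : 0 ≤ M) {g : G}
    (h : l.IsTame σ M (ρ g)) (hε : M * (2 + σ 1) ≤ ε) :
    IsSigmaCloseToId σ ε (l.diffeo ρ hc g) := by
  have hmono := hσ.strictMonoOn.monotoneOn
  have h01 : (0 : ℝ) ∈ Icc (0 : ℝ) 1 := left_mem_Icc.2 zero_le_one
  have h11 : (1 : ℝ) ∈ Icc (0 : ℝ) 1 := right_mem_Icc.2 zero_le_one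
  have hσ1 : 0 ≤ σ 1 := by
    rw [← hσ.map_zero]
    exact hmono h01 h11 zero_le_one
  have hMσ : M * σ 1 ≤ ε := by nlinarith
  have hdens : ∀ x ∈ Icc (0 : ℝ) 1, |l.density (ρ g) x - 1| ≤ ε := by
    intro x hx
    have h1 := h.abs_density_sub_one_le_of_notMem hmono hσ.map_zero hM hx h01
      fun ω _ h' => lt_irrefl _ (l.piece_subset ω h').1
    refine h1.trans (le_trans ?_ hMσ)
    rw [sub_zero, abs_of_nonneg hx.1]
    exact mul_le_mul_of_nonneg_left (hmono hx h11 hx.2) hM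
  have hε0 : 0 ≤ ε := (mul_nonneg hM hσ1).trans hMσ
  refine ⟨fun x => ?_, fun x hx => ?_, ?_⟩
  · rw [coe_diffeo, coe_homeo_apply]
    have h1 : l.realize (ρ g) x - x = ∫ t in (0)..(x : ℝ), (l.density (ρ g) t - 1) := by
      rw [intervalIntegral.integral_sub ((hc g).intervalIntegrable _ _)
        (continuous_const.intervalIntegrable _ _)]
      simp [realize]
    have h2 := intervalIntegral.norm_integral_le_of_norm_le_const (a := 0) (b := (x : ℝ)) (C := ε)
      (f := fun t => l.density (ρ g) t - 1) fun t ht => by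
        rw [uIoc_of_le x.2.1] at ht
        exact hdens t ⟨ht.1.le, ht.2.trans x.2.2⟩
    rw [h1]
    refine h2.trans ?_
    rw [sub_zero, abs_of_nonneg x.2.1]
    exact mul_le_of_le_one_right hε0 x.2.2
  · rw [coe_diffeo, intervalDeriv_homeo hc g hx]
    exact hdens x hx
  · intro x hx y hy hxy
    refine (sigmaNormLE_diffeo hc hσ hM h x hx y hy hxy).trans ?_
    nlinarith

end homeo

end LengthSystem

/-! ### Tameness for logarithmic moduli -/

theorem apply_exp_of_isLogModulus {σ : ℝ → ℝ} (hσ : IsLogModulus σ) {r : ℝ} (hr : 1 ≤ r) :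
    σ (Real.exp (-r)) = 1 / r := by
  rw [hσ.eq_log _ (Real.exp_pos _) (Real.exp_le_exp.2 (by linarith)), one_div (Real.exp _),
    ← Real.exp_neg, Real.log_exp, neg_neg]

theorem abs_sqrt_sub_le {q q' K : ℝ} (hq : 1 ≤ q) (hq' : 1 ≤ q') (h : |q - q'| ≤ K) :
    |√q - √q'| * √q ≤ K := by
  have h1 : (√q - √q') * (√q + √q') = q - q' := by
    have h2 := Real.sq_sqrt (show 0 ≤ q by linarith)
    have h3 := Real.sq_sqrt (show 0 ≤ q' by linarith)
    linear_combination h2 - h3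
  have h2 := Real.sqrt_nonneg q
  have h3 := Real.sqrt_nonneg q'
  calc |√q - √q'| * √q ≤ |√q - √q'| * (√q + √q') := by
        gcongr
        linarith
    _ = |(√q - √q') * (√q + √q')| := by
        rw [abs_mul, abs_of_nonneg (add_nonneg h2 h3)]
    _ ≤ K := by rwa [h1]

theorem abs_exp_sub_one_le_mul {u v : ℝ} (h : |u| ≤ v) : |Real.exp u - 1| ≤ v * Real.exp v := by
  have hv : 0 ≤ v := (abs_nonneg u).trans h
  obtain ⟨h1, h2⟩ := abs_le.1 h
  have hev : 1 ≤ Real.exp v := Real.one_le_exp hv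
  have hmul : Real.exp v * Real.exp (-v) = 1 := by rw [← Real.exp_add]; simp
  rw [abs_le]
  constructor
  · have := Real.add_one_le_exp u
    nlinarith
  · have h3 := Real.exp_le_exp.2 h2
    have h4 := Real.add_one_le_exp (-v)
    have h5 := Real.exp_pos v
    nlinarith

theorem abs_sin_sq_sub_le (x y : ℝ) : |Real.sin x ^ 2 - Real.sin y ^ 2| ≤ 2 * |x - y| := by
  have h1 : |Real.sin x - Real.sin y| ≤ |x - y| := by
    have := Real.lipschitzWith_sin.dist_le_mul x y
    simpa [Real.dist_eq] using this
  have h2 : |Real.sin x + Real.sin y| ≤ 2 := by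
    refine (abs_add_le _ _).trans ?_
    linarith [Real.abs_sin_le_one x, Real.abs_sin_le_one y]
  calc |Real.sin x ^ 2 - Real.sin y ^ 2|
      = |Real.sin x + Real.sin y| * |Real.sin x - Real.sin y| := by
        rw [← abs_mul]
        ring_nf
    _ ≤ 2 * |x - y| := mul_le_mul h2 h1 (abs_nonneg _) (by norm_num)

theorem abs_yoccozDeriv_sub_le {a b : ℝ} (ha : 0 < a) (hb : 0 < b) (x y : ℝ) :
    |yoccozDeriv a b x - yoccozDeriv a b y| ≤
      |(a / b) ^ 2 - 1| * (2 * (Real.pi * |x - y| / a)) / min 1 ((a / b) ^ 2) ^ 2 := by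
  have hpi := Real.pi_pos
  have hm : 0 < min 1 ((a / b) ^ 2) := lt_min one_pos (by positivity)
  have hx := min_le_yoccozDeriv_denom (a := a) (b := b) x
  have hy := min_le_yoccozDeriv_denom (a := a) (b := b) y
  have hs := abs_sin_sq_sub_le (Real.pi * y / a) (Real.pi * x / a)
  have hs' : |Real.pi * y / a - Real.pi * x / a| = Real.pi * |x - y| / a := by
    rw [← sub_div, ← mul_sub, abs_div, abs_mul, abs_of_pos hpi, abs_of_pos ha, abs_sub_comm]
  rw [hs'] at hs
  have hX := hm.trans_le hx
  have hY := hm.trans_le hy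
  rw [yoccozDeriv, yoccozDeriv, div_sub_div _ _ hX.ne' hY.ne', abs_div]
  refine div_le_div₀ (by positivity) ?_ (by positivity) ?_
  · have e : 1 * (1 + ((a / b) ^ 2 - 1) * Real.sin (Real.pi * y / a) ^ 2) -
        (1 + ((a / b) ^ 2 - 1) * Real.sin (Real.pi * x / a) ^ 2) * 1 =
        ((a / b) ^ 2 - 1) * (Real.sin (Real.pi * y / a) ^ 2 - Real.sin (Real.pi * x / a) ^ 2) := by
      ring
    rw [e, abs_mul]
    gcongr
  · rw [abs_of_pos (mul_pos hX hY), sq]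
    exact mul_le_mul hx hy hm.le hX.le

/-- With `a = exp (-√q)` and `b = exp (-√q')`, the ratio `a / b` differs from `1` by `O(K / √q)`, so
the derivative has Lipschitz constant `O(K / (√q * a))`. As `σ s / s` decreases and `σ a = 1 / √q`,
one has `|x - y| / a ≤ √q * σ |x - y|`, and the factors `√q` cancel. -/
theorem abs_yoccozDeriv_sub_le_of_isLogModulus {σ : ℝ → ℝ} (hσ : IsLogModulus σ) {q q' K : ℝ}
    (hq : 1 ≤ q) (hq' : 1 ≤ q') (h : |q - q'| ≤ K) {x y : ℝ}
    (hx : x ∈ Icc 0 (Real.exp (-√q))) (hy : y ∈ Icc 0 (Real.exp (-√q))) :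
    |yoccozDeriv (Real.exp (-√q)) (Real.exp (-√q')) x -
      yoccozDeriv (Real.exp (-√q)) (Real.exp (-√q')) y| ≤
      4 * Real.pi * K * Real.exp (6 * K) * σ |x - y| := by
  rcases eq_or_ne x y with rfl | hxy
  · simp [hσ.map_zero]
  have hpi := Real.pi_pos
  have hr : 1 ≤ √q := Real.one_le_sqrt.2 hq
  have hK := abs_sqrt_sub_le hq hq' h
  have hK0 : 0 ≤ K := (abs_nonneg _).trans h
  have hd0 : 0 < |x - y| := abs_pos.2 (sub_ne_zero.2 hxy)
  have hda : |x - y| ≤ Real.exp (-√q) :=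
    abs_le.2 ⟨by linarith [hx.1, hy.2], by linarith [hx.2, hy.1]⟩
  have ha1 : Real.exp (-√q) ≤ 1 := Real.exp_le_one_iff.2 (by linarith)
  have hdiff : |√q - √q'| ≤ K / √q := by rwa [le_div_iff₀ (by linarith)]
  have hdiffK : |√q - √q'| ≤ K := hdiff.trans (div_le_self hK0 hr)
  have hratio : (Real.exp (-√q) / Real.exp (-√q')) ^ 2 = Real.exp (2 * (√q' - √q)) := by
    rw [← Real.exp_sub, ← Real.exp_nat_mul]
    push_cast
    ring_nf
  have hu : |2 * (√q' - √q)| ≤ 2 * K / √q := by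
    rw [abs_mul, abs_two, abs_sub_comm, mul_div_assoc]
    linarith
  have huK : 2 * K / √q ≤ 2 * K := div_le_self (by linarith) hr
  have hκ : |(Real.exp (-√q) / Real.exp (-√q')) ^ 2 - 1| ≤ 2 * K / √q * Real.exp (2 * K) := by
    rw [hratio]
    refine (abs_exp_sub_one_le_mul hu).trans ?_
    gcongr
  have hmin : Real.exp (-(2 * K)) ≤ min 1 ((Real.exp (-√q) / Real.exp (-√q')) ^ 2) := by
    refine le_min (Real.exp_le_one_iff.2 (by linarith)) ?_
    rw [hratio]
    refine Real.exp_le_exp.2 ?_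
    linarith [(abs_le.1 (hu.trans huK)).1]
  have hσd : |x - y| / Real.exp (-√q) ≤ σ |x - y| * √q := by
    have h1 := hσ.antitoneOn ⟨hd0, hda.trans ha1⟩ ⟨Real.exp_pos _, ha1⟩ hda
    simp only [apply_exp_of_isLogModulus hσ hr] at h1
    rw [div_le_div_iff₀ (Real.exp_pos _) hd0, div_mul_eq_mul_div, one_mul,
      div_le_iff₀ (by linarith)] at h1
    rw [div_le_iff₀ (Real.exp_pos _)]
    linarith
  have hσ0 : 0 ≤ σ |x - y| * √q := (by positivity : (0 : ℝ) ≤ _).trans hσd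
  refine (abs_yoccozDeriv_sub_le (Real.exp_pos _) (Real.exp_pos _) x y).trans ?_
  calc _ ≤ (2 * K / √q * Real.exp (2 * K)) * (2 * (Real.pi * (σ |x - y| * √q))) /
        Real.exp (-(2 * K)) ^ 2 := by
        rw [mul_div_assoc Real.pi]
        gcongr
    _ = 4 * Real.pi * K * Real.exp (6 * K) * σ |x - y| := by
        have e : Real.exp (6 * K) = Real.exp (2 * K) / Real.exp (-(2 * K)) ^ 2 := by
          rw [← Real.exp_nat_mul, ← Real.exp_sub]
          push_cast
          ring_nf
        rw [e]
        have : √q ≠ 0 := by linarith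
        field_simp
        ring

/-! ### A logarithmic modulus of continuity -/

/-- The modulus `1 / log (1 / s)`, extended linearly beyond `1 / e`. -/
noncomputable def logModulus (s : ℝ) : ℝ :=
  if s ≤ Real.exp (-1) then 1 / Real.log (1 / s) else Real.exp 1 * s

theorem logModulus_of_le {s : ℝ} (hs : s ≤ Real.exp (-1)) : logModulus s = 1 / Real.log (1 / s) :=
  if_pos hs

theorem logModulus_of_ge {s : ℝ} (hs : Real.exp (-1) ≤ s) : logModulus s = Real.exp 1 * s := by
  rcases hs.eq_or_lt with rfl | hs
  · rw [logModulus_of_le le_rfl, one_div (Real.exp _), ← Real.exp_neg, Real.log_exp, ← Real.exp_add]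
    simp
  · exact if_neg (not_le.2 hs)

theorem one_le_log_one_div {s : ℝ} (h0 : 0 < s) (hs : s ≤ Real.exp (-1)) :
    1 ≤ Real.log (1 / s) := by
  rw [Real.le_log_iff_exp_le (by positivity), le_div_iff₀ h0]
  calc Real.exp 1 * s ≤ Real.exp 1 * Real.exp (-1) := by gcongr
    _ = 1 := by rw [← Real.exp_add]; simp

/-- The existence of one modulus is needed to deduce the first assertion from the second. The
quotient by `s` decreases near `0` because `log u / u` decreases for `u ≥ e`. -/
theorem isLogModulus_logModulus : IsLogModulus logModulus where
  map_zero := by simp [logModulus, (Real.exp_pos (-1)).le]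
  eq_log s _ hs := logModulus_of_le hs
  strictMonoOn := by
    have he := Real.exp_pos (-1)
    have h1 : StrictMonoOn logModulus (Icc 0 (Real.exp (-1))) := by
      intro x hx y hy hxy
      have hy0 : 0 < y := hx.1.trans_lt hxy
      have hly := one_le_log_one_div hy0 hy.2
      rw [logModulus_of_le hx.2, logModulus_of_le hy.2]
      rcases hx.1.eq_or_lt with rfl | hx0
      · simp only [div_zero, Real.log_zero]
        exact one_div_pos.2 (by linarith)
      · refine one_div_lt_one_div_of_lt (by linarith) (Real.log_lt_log (by positivity) ?_)
        exact one_div_lt_one_div_of_lt hx0 hxy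
    have h2 : StrictMonoOn logModulus (Icc (Real.exp (-1)) 1) := by
      intro x hx y hy hxy
      rw [logModulus_of_ge hx.1, logModulus_of_ge hy.1]
      gcongr
    have h3 := h1.union h2 (isGreatest_Icc he.le)
      (isLeast_Icc (Real.exp_le_one_iff.2 (by norm_num)))
    rwa [Icc_union_Icc_eq_Icc he.le (Real.exp_le_one_iff.2 (by norm_num))] at h3
  antitoneOn := by
    have h1 : AntitoneOn (fun s => logModulus s / s) (Ioc 0 (Real.exp (-1))) := by
      intro x hx y hy hxy
      have hlx := one_le_log_one_div hx.1 hx.2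
      have hly := one_le_log_one_div hy.1 hy.2
      simp only [logModulus_of_le hx.2, logModulus_of_le hy.2, div_div]
      have hmem {s : ℝ} (hs : s ∈ Ioc 0 (Real.exp (-1))) : 1 / s ∈ {x | Real.exp 1 ≤ x} := by
        rw [Set.mem_ofPred_eq, le_div_iff₀ hs.1]
        calc Real.exp 1 * s ≤ Real.exp 1 * Real.exp (-1) := by
              have := hs.2
              gcongr
          _ = 1 := by rw [← Real.exp_add]; simp
      have h := Real.log_div_self_antitoneOn (hmem hy) (hmem hx)
        (one_div_le_one_div_of_le hx.1 hxy)
      simp only [div_div_eq_mul_div, div_one] at h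
      have hx0 := hx.1
      exact one_div_le_one_div_of_le (by positivity) h
    have h2 : AntitoneOn (fun s => logModulus s / s) (Icc (Real.exp (-1)) 1) := by
      intro x hx y hy _
      have he := Real.exp_pos (-1)
      have hx0 : x ≠ 0 := (he.trans_le hx.1).ne'
      have hy0 : y ≠ 0 := (he.trans_le hy.1).ne'
      simp only [logModulus_of_ge hx.1, logModulus_of_ge hy.1, mul_div_assoc, div_self hx0,
        div_self hy0, le_refl]
    have he := Real.exp_pos (-1)
    have he1 : Real.exp (-1) ≤ 1 := Real.exp_le_one_iff.2 (by norm_num)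
    have h3 := h1.union_right h2 ⟨right_mem_Ioc.2 he, fun x hx => hx.2⟩ (isLeast_Icc he1)
    rwa [Ioc_union_Icc_eq_Ioc he he1] at h3
  continuousOn := by
    have he := Real.exp_pos (-1)
    have he1 : Real.exp (-1) ≤ 1 := Real.exp_le_one_iff.2 (by norm_num)
    have h1 : ContinuousOn logModulus (Icc 0 (Real.exp (-1))) := by
      intro x hx
      rcases hx.1.eq_or_lt with rfl | hx0
      · have hlim : Tendsto (fun s : ℝ => 1 / Real.log (1 / s)) (𝓝[>] 0) (𝓝 0) := by
          simp only [one_div]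
          exact (Real.tendsto_log_atTop.comp tendsto_inv_nhdsGT_zero).inv_tendsto_atTop
        have h0 : logModulus 0 = 0 := by simp [logModulus, he.le]
        rw [← continuousWithinAt_sdiff_self, Icc_sdiff_left, ContinuousWithinAt, h0]
        refine (hlim.mono_left (nhdsWithin_mono 0 fun y hy => hy.1)).congr' ?_
        filter_upwards [self_mem_nhdsWithin] with y hy
        exact (logModulus_of_le hy.2).symm
      · have hne : Real.log (1 / x) ≠ 0 := by linarith [one_le_log_one_div hx0 hx.2]
        have : ContinuousAt (fun s : ℝ => 1 / Real.log (1 / s)) x :=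
          continuousAt_const.div ((continuousAt_const.div continuousAt_id hx0.ne').log
            (one_div_pos.2 hx0).ne') hne
        exact this.continuousWithinAt.congr (fun y hy => logModulus_of_le hy.2)
          (logModulus_of_le hx.2)
    have h2 : ContinuousOn logModulus (Icc (Real.exp (-1)) 1) :=
      (continuousOn_const.mul continuousOn_id).congr fun x hx => logModulus_of_ge hx.1
    have h3 := h1.union_of_isClosed h2 isClosed_Icc isClosed_Icc
    rwa [Icc_union_Icc_eq_Icc he.le he1] at h3

/-! ### The action on finite words -/

/-- The total displacement of the entries of any sequence is at most `B`. -/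
def DisplacesAtMost (B : ℕ) (g : Equiv.Perm (ℕ → ℤ)) : Prop :=
  ∀ (n : ℕ) (l : ℕ → ℤ), ∑ i ∈ Finset.range n, |g l i - l i| ≤ B

/-- The sections of a generator along a sequence stay generators until `a` occurs, and from then on
they are trivial: at most one entry moves, by one. -/
theorem displacesAtMost_gmPerm (s : GMLabel) : DisplacesAtMost 1 (gmPerm s) := by
  intro n
  induction n generalizing s with
  | zero => intro l; simp
  | succ n ih =>
    intro l
    rw [Finset.sum_range_succ']
    have h1 := ih (s.next (l 0)) (seqTail l)
    have h2 : ∀ i, gmPerm s l (i + 1) = gmPerm (s.next (l 0)) (seqTail l) i := fun _ => rfl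
    have h3 : gmPerm s l 0 = l 0 + 1 * s.shift := rfl
    simp only [h2, h3]
    simp only [seqTail_apply] at h1
    cases s with
    | a =>
      have h4 : GMLabel.a.next (l 0) = .one := rfl
      rw [h4, gmPerm_one]
      simp [GMLabel.shift]
    | _ => simpa [GMLabel.shift] using h1

theorem DisplacesAtMost.mul {B C : ℕ} {g h : Equiv.Perm (ℕ → ℤ)} (hg : DisplacesAtMost B g)
    (hh : DisplacesAtMost C h) : DisplacesAtMost (B + C) (g * h) := by
  intro n l
  have h1 := hg n (h l)
  have h2 := hh n l
  push_cast
  calc ∑ i ∈ Finset.range n, |(g * h) l i - l i|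
      ≤ ∑ i ∈ Finset.range n, (|g (h l) i - h l i| + |h l i - l i|) :=
        Finset.sum_le_sum fun i _ => abs_sub_le _ _ _
    _ ≤ B + C := by
        rw [Finset.sum_add_distrib]
        linarith

theorem DisplacesAtMost.inv {B : ℕ} {g : Equiv.Perm (ℕ → ℤ)} (hg : DisplacesAtMost B g) :
    DisplacesAtMost B g⁻¹ := by
  intro n l
  have h1 := hg n (g⁻¹ l)
  have e : g (g⁻¹ l) = l := g.apply_symm_apply l
  rw [e] at h1
  refine le_of_eq_of_le (Finset.sum_congr rfl fun i _ => abs_sub_comm _ _) h1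

theorem exists_displacesAtMost {g : Equiv.Perm (ℕ → ℤ)} (hg : g ∈ grigorchukMaki) :
    ∃ B, DisplacesAtMost B g := by
  refine closure_induction (P := fun g => ∃ B, DisplacesAtMost B g) ⟨0, fun n l => by simp⟩
    (fun s => ⟨1, displacesAtMost_gmPerm s⟩) ?_ ?_ hg
  · rintro g h ⟨B, hB⟩ ⟨C, hC⟩
    exact ⟨B + C, hB.mul hC⟩
  · rintro g ⟨B, hB⟩
    exact ⟨B, hB.inv⟩

theorem IsTriangular.congr {g : Equiv.Perm (ℕ → ℤ)} (hg : IsTriangular g) {n : ℕ} {l l' : ℕ → ℤ}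
    (h : ∀ j < n, l j = l' j) : ∀ j < n, g l j = g l' j := by
  intro j hj
  have h1 := hg j l l' fun i hi => by rw [h i (hi.trans hj)]
  rw [h j hj] at h1
  linarith

/-- The extension of a finite word by zeros. -/
def padWord {n : ℕ} (w : Fin n → ℤ) : ℕ → ℤ := fun k => if h : k < n then w ⟨k, h⟩ else 0

theorem padWord_apply {n : ℕ} (w : Fin n → ℤ) (i : Fin n) : padWord w i = w i := by
  simp [padWord]

theorem padWord_of_lt {n : ℕ} (w : Fin n → ℤ) {i : ℕ} (hi : i < n) : padWord w i = w ⟨i, hi⟩ := by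
  simp [padWord, hi]

/-- The map induced by a permutation of sequences on words of length `n`. -/
def wordMap (g : Equiv.Perm (ℕ → ℤ)) {n : ℕ} (w : Fin n → ℤ) : Fin n → ℤ := fun i => g (padWord w) i

theorem wordMap_one {n : ℕ} (w : Fin n → ℤ) : wordMap 1 w = w :=
  funext fun i => padWord_apply w i

theorem wordMap_mul {g : Equiv.Perm (ℕ → ℤ)} (hg : IsTriangular g) (h : Equiv.Perm (ℕ → ℤ))
    {n : ℕ} (w : Fin n → ℤ) : wordMap (g * h) w = wordMap g (wordMap h w) := by
  funext i
  refine hg.congr (n := n) (fun j hj => ?_) i i.2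
  rw [padWord_of_lt _ hj]
  rfl

/-- At the first place where two words differ, both entries are translated by the same amount. -/
theorem wordMap_lt {g : Equiv.Perm (ℕ → ℤ)} (hg : IsTriangular g) {n : ℕ} {w w' : Fin n → ℤ}
    (h : toLex w < toLex w') : toLex (wordMap g w) < toLex (wordMap g w') := by
  obtain ⟨i, h1, h2⟩ := h
  have hpad : ∀ j < (i : ℕ), padWord w j = padWord w' j := by
    intro j hj
    rw [padWord_of_lt w (hj.trans i.2), padWord_of_lt w' (hj.trans i.2)]
    exact h1 ⟨j, hj.trans i.2⟩ hj
  refine ⟨i, fun j hj => hg.congr hpad j hj, ?_⟩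
  have h3 := hg i (padWord w) (padWord w') fun j hj => by rw [hpad j hj]
  rw [padWord_apply, padWord_apply] at h3
  have h2' : w i < w' i := h2
  show g (padWord w) i < g (padWord w') i
  linarith

/-- The set of finite words, ordered by length and then lexicographically. -/
abbrev Word : Type := Σₗ n : ℕ, Lex (Fin n → ℤ)

/-- The word `w`, of length `n`. -/
def mkWord (n : ℕ) (w : Fin n → ℤ) : Word := toLex ⟨n, toLex w⟩

/-- The bijection between words and pairs. -/
def wordEquiv : (Σ n : ℕ, Fin n → ℤ) ≃ Word where
  toFun p := mkWord p.1 p.2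
  invFun ω := ⟨(ofLex ω).1, ofLex (ofLex ω).2⟩
  left_inv _ := rfl
  right_inv _ := rfl

instance : Countable Word := wordEquiv.symm.injective.countable

/-- The map induced by a permutation of sequences on words. -/
def wordAct (g : Equiv.Perm (ℕ → ℤ)) (ω : Word) : Word :=
  mkWord (ofLex ω).1 (wordMap g (ofLex (ofLex ω).2))

theorem wordAct_strictMono {g : Equiv.Perm (ℕ → ℤ)} (hg : IsTriangular g) :
    StrictMono (wordAct g) := by
  rintro ω ω' h
  obtain ⟨⟨n, w⟩, rfl⟩ := wordEquiv.surjective ω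
  obtain ⟨⟨m, w'⟩, rfl⟩ := wordEquiv.surjective ω'
  cases h with
  | left _ _ h => exact Sigma.Lex.left _ _ h
  | right _ _ h => exact Sigma.Lex.right _ _ (wordMap_lt hg h)

theorem wordAct_one (ω : Word) : wordAct 1 ω = ω := by
  obtain ⟨⟨n, w⟩, rfl⟩ := wordEquiv.surjective ω
  exact congrArg (mkWord n) (wordMap_one w)

theorem wordAct_mul {g : Equiv.Perm (ℕ → ℤ)} (hg : IsTriangular g) (h : Equiv.Perm (ℕ → ℤ))
    (ω : Word) : wordAct (g * h) ω = wordAct g (wordAct h ω) := by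
  obtain ⟨⟨n, w⟩, rfl⟩ := wordEquiv.surjective ω
  exact congrArg (mkWord n) (wordMap_mul hg h w)

theorem wordAct_inv_wordAct {g : Equiv.Perm (ℕ → ℤ)} (hg : g ∈ grigorchukMaki) (ω : Word) :
    wordAct g⁻¹ (wordAct g ω) = ω := by
  rw [← wordAct_mul (isTriangular_of_mem (inv_mem hg)), inv_mul_cancel, wordAct_one]

/-- The order preserving action of the Grigorchuk–Maki group on words. -/
def wordHom : grigorchukMaki →* (Word ≃o Word) where
  toFun g :=
    { toFun := wordAct g
      invFun := wordAct (g⁻¹ : grigorchukMaki)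
      left_inv := fun ω => wordAct_inv_wordAct g.2 ω
      right_inv := fun ω => by
        have := wordAct_inv_wordAct (inv_mem g.2) ω
        rwa [inv_inv] at this
      map_rel_iff' := (wordAct_strictMono (isTriangular_of_mem g.2)).le_iff_le }
  map_one' := DFunLike.ext _ _ fun ω => wordAct_one ω
  map_mul' g h := DFunLike.ext _ _ fun ω => wordAct_mul (isTriangular_of_mem g.2) h ω

theorem wordHom_apply (g : grigorchukMaki) (ω : Word) : wordHom g ω = wordAct g ω := rfl

theorem wordHom_injective : Function.Injective wordHom := by
  rw [injective_iff_map_eq_one]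
  intro g hg
  refine Subtype.ext (Equiv.ext fun l => funext fun n => ?_)
  have h1 : wordAct g (mkWord (n + 1) fun i => l i) = mkWord (n + 1) fun i => l i := by
    rw [← wordHom_apply, hg]
    rfl
  have h2 : wordMap g.1 (fun i : Fin (n + 1) => l i) = fun i : Fin (n + 1) => l i := by
    have := wordEquiv.injective (a₁ := ⟨n + 1, wordMap g.1 fun i => l i⟩)
      (a₂ := ⟨n + 1, fun i => l i⟩) h1
    simpa using this
  have h3 := congrFun h2 (Fin.last n)
  have h4 := (isTriangular_of_mem g.2).congr (n := n + 1) (l := padWord fun i : Fin (n + 1) => l i)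
    (l' := l) (fun j hj => padWord_of_lt _ hj) n (Nat.lt_succ_self n)
  exact h4.symm.trans h3

/-! ### Lengths -/

theorem summable_exp_neg_mul_sqrt {c : ℝ} (hc : 0 < c) :
    Summable fun k : ℤ => Real.exp (-c * √|(k : ℝ)|) := by
  have h : Summable fun n : ℕ => Real.exp (-c * √(n : ℝ)) := by
    rw [← summable_nat_add_iff 1]
    have h1 : Summable fun n : ℕ => 24 / c ^ 4 * (1 / ((n + 1 : ℕ) : ℝ) ^ 2) :=
      ((summable_nat_add_iff 1).2 (Real.summable_one_div_nat_pow.2 one_lt_two)).mul_left _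
    refine h1.of_nonneg_of_le (fun _ => (Real.exp_pos _).le) fun n => ?_
    -- The fourth power of the square root yields the summable comparison `24 / (c ^ 4 * (n + 1) ^
    -- 2)`.
    have h2 := Real.pow_div_factorial_le_exp (c * √((n + 1 : ℕ) : ℝ)) (by positivity) 4
    have h3 : (c * √((n + 1 : ℕ) : ℝ)) ^ 4 = c ^ 4 * ((n + 1 : ℕ) : ℝ) ^ 2 := by
      have := Real.sq_sqrt (Nat.cast_nonneg (α := ℝ) (n + 1))
      calc (c * √((n + 1 : ℕ) : ℝ)) ^ 4 = c ^ 4 * (√((n + 1 : ℕ) : ℝ) ^ 2) ^ 2 := by ring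
        _ = _ := by rw [this]
    rw [h3] at h2
    have h4 : 24 / c ^ 4 * (1 / ((n + 1 : ℕ) : ℝ) ^ 2) =
        (c ^ 4 * ((n + 1 : ℕ) : ℝ) ^ 2 / (Nat.factorial 4 : ℝ))⁻¹ := by
      have : (Nat.factorial 4 : ℝ) = 24 := by norm_num [Nat.factorial]
      rw [this]
      field_simp
    rw [neg_mul, Real.exp_neg, h4]
    exact inv_anti₀ (by positivity) h2
  refine Summable.of_nat_of_neg ?_ ?_ <;> simpa using h

theorem summable_exp_neg_mul_sum_sqrt {c : ℝ} (hc : 0 < c) (n : ℕ) :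
    Summable fun w : Fin n → ℤ => Real.exp (-c * ∑ i, √|(w i : ℝ)|) := by
  induction n with
  | zero => exact (hasSum_fintype _).summable
  | succ n ih =>
    rw [← (Fin.consEquiv fun _ : Fin (n + 1) => ℤ).summable_iff]
    refine ((summable_exp_neg_mul_sqrt hc).mul_of_nonneg ih (fun _ => (Real.exp_pos _).le)
      fun _ => (Real.exp_pos _).le).congr fun p => ?_
    simp only [Function.comp_apply, Fin.consEquiv_apply, Fin.sum_univ_succ, Fin.cons_zero,
      Fin.cons_succ, mul_add, Real.exp_add]

/-- The `ℓ¹`-norm of a word. -/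
noncomputable def wordNorm {n : ℕ} (w : Fin n → ℤ) : ℝ := ∑ i, |(w i : ℝ)|

theorem wordNorm_nonneg {n : ℕ} (w : Fin n → ℤ) : 0 ≤ wordNorm w :=
  Finset.sum_nonneg fun _ _ => abs_nonneg _

theorem summable_exp_neg_sqrt_wordNorm {K : ℝ} (hK : 0 < K) (n : ℕ) :
    Summable fun w : Fin n → ℤ => Real.exp (-(√(K * wordNorm w) / 2)) := by
  have hc : 0 < √K / (2 * (n + 1)) := by positivity
  refine (summable_exp_neg_mul_sum_sqrt hc n).of_nonneg_of_le (fun _ => (Real.exp_pos _).le)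
    fun w => Real.exp_le_exp.2 ?_
  have h1 : ∑ i, √|(w i : ℝ)| ≤ (n + 1) * √(wordNorm w) := by
    calc ∑ i, √|(w i : ℝ)| ≤ ∑ _i : Fin n, √(wordNorm w) := by
          refine Finset.sum_le_sum fun i _ => Real.sqrt_le_sqrt ?_
          exact Finset.single_le_sum (f := fun i => |(w i : ℝ)|) (fun _ _ => abs_nonneg _)
            (Finset.mem_univ i)
      _ = n * √(wordNorm w) := by simp
      _ ≤ _ := by
          have := Real.sqrt_nonneg (wordNorm w)
          linarith
  rw [Real.sqrt_mul hK.le, neg_mul, neg_le_neg_iff]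
  calc √K / (2 * (n + 1)) * ∑ i, √|(w i : ℝ)| ≤ √K / (2 * (n + 1)) * ((n + 1) * √(wordNorm w)) := by
        gcongr
    _ = √K * √(wordNorm w) / 2 := by
        field_simp

/-- The size of words of length `n` can be shifted to make the total length small. -/
theorem exists_shift {K : ℝ} (hK : 0 < K) (n : ℕ) {δ : ℝ} (hδ : 0 < δ) : ∃ C : ℝ, 1 ≤ C ∧
    Summable (fun w : Fin n → ℤ => Real.exp (-√(K * wordNorm w + C))) ∧
    ∑' w : Fin n → ℤ, Real.exp (-√(K * wordNorm w + C)) ≤ δ := by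
  have hs := summable_exp_neg_sqrt_wordNorm hK n
  set T := ∑' w : Fin n → ℤ, Real.exp (-(√(K * wordNorm w) / 2)) with hT
  have hT0 : 0 ≤ T := tsum_nonneg fun _ => (Real.exp_pos _).le
  -- With shift `(2 * r) ^ 2`, half of the square root keeps the series summable with sum `T` and
  -- the other half supplies `exp (-r) ≤ 1 / r`; the choice of `r` gives `T ≤ r * δ`.
  set r : ℝ := 1 + T / δ with hr
  have hr1 : 1 ≤ r := le_add_of_nonneg_right (by positivity)
  have hbound : ∀ w : Fin n → ℤ, Real.exp (-√(K * wordNorm w + (2 * r) ^ 2)) ≤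
      Real.exp (-r) * Real.exp (-(√(K * wordNorm w) / 2)) := by
    intro w
    have h0 : 0 ≤ K * wordNorm w := mul_nonneg hK.le (wordNorm_nonneg w)
    have h1 : √(K * wordNorm w) ≤ √(K * wordNorm w + (2 * r) ^ 2) :=
      Real.sqrt_le_sqrt (by nlinarith [sq_nonneg (2 * r)])
    have h2 : 2 * r ≤ √(K * wordNorm w + (2 * r) ^ 2) := Real.le_sqrt_of_sq_le (by linarith)
    rw [← Real.exp_add]
    exact Real.exp_le_exp.2 (by linarith)
  have hsum := (hs.mul_left (Real.exp (-r))).of_nonneg_of_le (fun _ => (Real.exp_pos _).le) hbound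
  refine ⟨(2 * r) ^ 2, by nlinarith, hsum, ?_⟩
  refine (hsum.tsum_le_tsum hbound (hs.mul_left _)).trans ?_
  rw [tsum_mul_left, ← hT]
  have h3 : Real.exp (-r) ≤ 1 / r := by
    rw [Real.exp_neg, ← one_div]
    refine one_div_le_one_div_of_le (by linarith) ?_
    linarith [Real.add_one_le_exp r]
  have h4 : T ≤ r * δ := by
    rw [hr, add_mul, div_mul_cancel₀ _ hδ.ne']
    linarith
  calc Real.exp (-r) * T ≤ 1 / r * (r * δ) := by gcongr
    _ = δ := by field_simp

/-- A length system on words for which the logarithms of the lengths vary slowly. -/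
theorem exists_lengthSystem {K : ℝ} (hK : 0 < K) : ∃ (l : LengthSystem Word) (C : ℕ → ℝ),
    (∀ n, 1 ≤ C n) ∧ ∀ (n : ℕ) (w : Fin (n + 1) → ℤ),
      l.len (mkWord (n + 1) w) = Real.exp (-√(K * wordNorm w + C n)) := by
  choose C hC1 hCs hCsum using fun n : ℕ =>
    exists_shift hK (n + 1) (δ := (1 / 2) ^ (n + 2)) (by positivity)
  let f : (Σ n : ℕ, Fin n → ℤ) → ℝ
    | ⟨0, _⟩ => 0
    | ⟨n + 1, w⟩ => Real.exp (-√(K * wordNorm w + C n))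
  have hf0 : ∀ p, 0 ≤ f p := by
    rintro ⟨n, w⟩
    cases n with
    | zero => exact le_rfl
    | succ n => exact (Real.exp_pos _).le
  let g : ℕ → ℝ := fun n => ∑' w : Fin n → ℤ, f ⟨n, w⟩
  have hg0 : g 0 = 0 := tsum_zero
  have hgs : ∀ n, g (n + 1) ≤ (1 / 2) ^ (n + 2) := hCsum
  have hgnn : ∀ n, 0 ≤ g n := fun n => tsum_nonneg fun w => hf0 _
  have hfib : ∀ n, Summable fun w : Fin n → ℤ => f ⟨n, w⟩ := by
    intro n
    cases n with
    | zero => exact summable_zero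
    | succ n => exact hCs n
  have hgeom : HasSum (fun n : ℕ => ((1 : ℝ) / 2) ^ (n + 2)) (1 / 2) := by
    have := (hasSum_geometric_two).mul_left (1 / 4)
    have e : (1 : ℝ) / 4 * 2 = 1 / 2 := by norm_num
    rw [e] at this
    refine this.congr_fun fun n => ?_
    ring
  have hg1 : Summable fun n => g (n + 1) :=
    hgeom.summable.of_nonneg_of_le (fun n => hgnn _) hgs
  have hg : Summable g := (summable_nat_add_iff 1).1 hg1
  have hfs : Summable f := (summable_sigma_of_nonneg hf0).2 ⟨hfib, hg⟩
  have htot : ∑' p, f p ≤ 1 / 2 := by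
    have h1 : ∑' p, f p = ∑' n, g n := hfs.tsum_sigma' hfib
    rw [h1, hg.tsum_eq_zero_add, hg0, zero_add, ← hgeom.tsum_eq]
    exact hg1.tsum_le_tsum hgs hgeom.summable
  let root : Σ n : ℕ, Fin n → ℤ := ⟨0, Fin.elim0⟩
  classical
  -- The nonempty words use total length at most `1 / 2`. The empty word, fixed by the group,
  -- receives the remainder, so its length needs no special form.
  let len : (Σ n : ℕ, Fin n → ℤ) → ℝ := fun p => f p + if p = root then 1 - ∑' p, f p else 0
  have hsum : HasSum len 1 := by
    have := hfs.hasSum.add (hasSum_ite_eq root (1 - ∑' p, f p))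
    rwa [add_sub_cancel] at this
  have hpos : ∀ p, 0 < len p := by
    rintro ⟨n, w⟩
    cases n with
    | zero =>
      have : (⟨0, w⟩ : Σ n : ℕ, Fin n → ℤ) = root := by
        simp only [root, Sigma.mk.injEq, true_and, heq_eq_eq]
        exact Subsingleton.elim _ _
      have h0 : f root = 0 := rfl
      simp only [len, this, h0, if_true]
      linarith
    | succ n =>
      have : (⟨n + 1, w⟩ : Σ n : ℕ, Fin n → ℤ) ≠ root := by
        intro h
        have := congrArg Sigma.fst h
        simp [root] at this
      simp only [len, this, if_false, add_zero]
      exact Real.exp_pos _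
  refine ⟨⟨fun ω => len (wordEquiv.symm ω), fun ω => hpos _, ?_⟩, C, hC1, fun n w => ?_⟩
  · exact (wordEquiv.symm.hasSum_iff (f := len)).2 hsum
  · have : (⟨n + 1, w⟩ : Σ n : ℕ, Fin n → ℤ) ≠ root := by
      intro h
      have := congrArg Sigma.fst h
      simp [root] at this
    show len ⟨n + 1, w⟩ = _
    simp only [len, this, if_false, add_zero]
    rfl

theorem abs_wordNorm_sub_le {B : ℕ} {g : Equiv.Perm (ℕ → ℤ)} (hg : DisplacesAtMost B g) {n : ℕ}
    (w : Fin n → ℤ) : |wordNorm w - wordNorm (wordMap g w)| ≤ B := by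
  have h1 := hg n (padWord w)
  rw [Finset.sum_range] at h1
  have h2 : ∑ i : Fin n, |((wordMap g w i : ℤ) : ℝ) - w i| ≤ B := by
    simp only [padWord_apply] at h1
    exact_mod_cast h1
  rw [wordNorm, wordNorm, ← Finset.sum_sub_distrib]
  refine (Finset.abs_sum_le_sum_abs _ _).trans (le_trans (Finset.sum_le_sum fun i _ => ?_) h2)
  rw [abs_sub_comm (wordMap g w i : ℝ)]
  exact abs_abs_sub_abs_le_abs_sub _ _

/-- Word length is preserved, so the shift `C n` is the same before and after, and the arguments of
the square roots differ by at most `K * B`. On the empty word the derivative is `1`. -/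
theorem isTame_wordHom {K : ℝ} (hK : 0 < K) {l : LengthSystem Word} {C : ℕ → ℝ}
    (hC : ∀ n, 1 ≤ C n) (hl : ∀ (n : ℕ) (w : Fin (n + 1) → ℤ),
      l.len (mkWord (n + 1) w) = Real.exp (-√(K * wordNorm w + C n)))
    {σ : ℝ → ℝ} (hσ : IsLogModulus σ) {B : ℕ} {g : grigorchukMaki} (hg : DisplacesAtMost B g) :
    l.IsTame σ (4 * Real.pi * (K * B) * Real.exp (6 * (K * B))) (wordHom g) := by
  intro ω x hx y hy
  obtain ⟨⟨n, w⟩, rfl⟩ := wordEquiv.surjective ω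
  have hpi := Real.pi_pos
  rw [wordHom_apply]
  change |yoccozDeriv (l.len (mkWord n w)) (l.len (mkWord n (wordMap g w))) x -
    yoccozDeriv (l.len (mkWord n w)) (l.len (mkWord n (wordMap g w))) y| ≤ _
  change x ∈ Icc 0 (l.len (mkWord n w)) at hx
  change y ∈ Icc 0 (l.len (mkWord n w)) at hy
  cases n with
  | zero =>
    have e : wordMap g w = w := Subsingleton.elim _ _
    have hlen := l.len_pos (mkWord 0 w)
    have hle : l.len (mkWord 0 w) ≤ 1 := by
      linarith [l.left_add_len_le_one (mkWord 0 w), l.left_nonneg (mkWord 0 w)]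
    have hσ0 : 0 ≤ σ |x - y| := by
      rw [← hσ.map_zero]
      refine hσ.strictMonoOn.monotoneOn (left_mem_Icc.2 zero_le_one) ⟨abs_nonneg _, ?_⟩
        (abs_nonneg _)
      exact abs_le.2 ⟨by linarith [hx.1, hy.2], by linarith [hx.2, hy.1]⟩
    rw [e, yoccozDeriv_self hlen, yoccozDeriv_self hlen, sub_self, abs_zero]
    positivity
  | succ n =>
    rw [hl] at hx hy
    rw [hl, hl]
    have hq : ∀ w : Fin (n + 1) → ℤ, 1 ≤ K * wordNorm w + C n := fun w => by
      have := mul_nonneg hK.le (wordNorm_nonneg w)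
      linarith [hC n]
    refine abs_yoccozDeriv_sub_le_of_isLogModulus hσ (hq w) (hq _) ?_ hx hy
    rw [add_sub_add_right_eq_sub, ← mul_sub, abs_mul, abs_of_pos hK]
    exact mul_le_mul_of_nonneg_left (abs_wordNorm_sub_le hg w) hK.le

theorem exists_hom_diffOne {σ : ℝ → ℝ} (hσ : IsLogModulus σ) {ε : ℝ} (hε : 0 < ε) :
    ∃ φ : grigorchukMaki →* diffOne, Function.Injective φ ∧
      (∀ h : grigorchukMaki, φ h ∈ diffOneSigma σ) ∧
      ∀ h : grigorchukMaki, (h : Equiv.Perm (ℕ → ℤ)) ∈ gmGenerators →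
        IsSigmaCloseToId σ ε (φ h) ∧ IsSigmaCloseToId σ ε (φ h)⁻¹ := by
  have hpi := Real.pi_pos
  -- The generators and their inverses have displacement bound `1`, so the tameness constant tends
  -- to `0` with `K`. The factor `2 + σ 1` covers both the `σ`-norm and the uniform distance of the
  -- derivative to `1`.
  obtain ⟨K, hK, hKε⟩ : ∃ K : ℝ, 0 < K ∧
      4 * Real.pi * (K * (1 : ℕ)) * Real.exp (6 * (K * (1 : ℕ))) * (2 + σ 1) < ε := by
    have hcont : Continuous fun K : ℝ =>
        4 * Real.pi * (K * (1 : ℕ)) * Real.exp (6 * (K * (1 : ℕ))) * (2 + σ 1) := by fun_prop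
    have h0 := (hcont.tendsto' 0 0 (by simp)).eventually (gt_mem_nhds hε)
    obtain ⟨K, h1, h2⟩ := ((h0.filter_mono nhdsWithin_le_nhds).and
      (self_mem_nhdsWithin : Ioi (0 : ℝ) ∈ 𝓝[>] 0)).exists
    exact ⟨K, h2, h1⟩
  obtain ⟨l, C, hC, hl⟩ := exists_lengthSystem hK
  have htame : ∀ g : grigorchukMaki, ∃ M, 0 ≤ M ∧ l.IsTame σ M (wordHom g) := by
    intro g
    obtain ⟨B, hB⟩ := exists_displacesAtMost g.2
    exact ⟨_, by positivity, isTame_wordHom hK hC hl hσ hB⟩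
  have hc : ∀ g, Continuous (l.density (wordHom g)) := by
    intro g
    obtain ⟨M, hM, h⟩ := htame g
    exact h.continuous_density hσ.strictMonoOn.monotoneOn hσ.map_zero
      (hσ.continuousOn 0 (left_mem_Icc.2 zero_le_one)) hM
  have hnorm : ∀ g, ∃ M, SigmaNormLE σ (intervalDeriv (l.diffeo wordHom hc g).1) M := by
    intro g
    obtain ⟨M, hM, h⟩ := htame g
    exact ⟨2 * M, LengthSystem.sigmaNormLE_diffeo hc hσ hM h⟩
  have hclose : ∀ g : grigorchukMaki, DisplacesAtMost 1 g →
      IsSigmaCloseToId σ ε (l.diffeo wordHom hc g) := fun g hg =>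
    LengthSystem.isSigmaCloseToId_diffeo hc hσ (by positivity)
      (isTame_wordHom hK hC hl hσ hg) hKε.le
  refine ⟨l.diffeo wordHom hc, LengthSystem.diffeo_injective hc wordHom_injective,
    fun h => ⟨hnorm h, ?_⟩, fun h hh => ?_⟩
  · have := hnorm h⁻¹
    rwa [map_inv] at this
  · have h1 : DisplacesAtMost 1 (h : Equiv.Perm (ℕ → ℤ)) := by
      rcases hh with e | e | e | e <;>
      · rw [e]
        exact displacesAtMost_gmPerm _
    rw [← map_inv]
    exact ⟨hclose h h1, hclose h⁻¹ h1.inv⟩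

end GrigorchukMaki

theorem theoremA :
    (∃ Γ : Subgroup diffOne, Γ.FG ∧ HasIntermediateGrowth Γ ∧ Nonempty (grigorchukMaki ≃* Γ)) ∧
    ∀ σ : ℝ → ℝ, IsLogModulus σ → ∀ ε : ℝ, 0 < ε →
      ∃ φ : grigorchukMaki →* diffOne,
        Function.Injective φ ∧
        (∀ h : grigorchukMaki, φ h ∈ diffOneSigma σ) ∧
        ∀ h : grigorchukMaki, (h : Equiv.Perm (ℕ → ℤ)) ∈ gmGenerators →
          IsSigmaCloseToId σ ε (φ h) ∧ IsSigmaCloseToId σ ε (φ h)⁻¹ := by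
  refine ⟨?_, fun σ hσ ε hε => GrigorchukMaki.exists_hom_diffOne hσ hε⟩
  obtain ⟨φ, hφ, -⟩ := GrigorchukMaki.exists_hom_diffOne GrigorchukMaki.isLogModulus_logModulus one_pos
  have e : grigorchukMaki ≃* φ.range := MonoidHom.ofInjective hφ
  have hgrowth := GrigorchukMaki.hasIntermediateGrowth_of_mulEquiv e
  exact ⟨φ.range, (Group.fg_iff_subgroup_fg _).1 hgrowth.1, hgrowth, ⟨e⟩⟩
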